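/- **Setting.** Let $\overline\gamma_0>0$ be a constant and let $\gamma_n:\mathbb{R}^+\to\mathbb{R}^+$, $n\ge 1$, be measurable functions with $\sup_{n\ge1}\int_0^\infty\gamma_n(t)\,dt<1$. Let $(N^n)_{n\ge0}$ be the generations of the stationary Hawkes process on $\mathbb{R}$ with exciting functions $(\gamma_n)$: the $N^n$ are simple, locally finite point processes on $\mathbb{R}$; $N^0$ is a homogeneous Poisson process on $\mathbb{R}$ with rate $\overline\gamma_0$; and for every $n\ge0$, conditionally on $N^0,\dots,N^n$, the process $N^{n+1}$ is an inhomogeneous Poisson process on $\mathbb{R}$ with intensity $\lambda^{n+1}_t=\int_{(-\infty,t)}\gamma_{n+1}(t-s)\,N^{n}(ds)$. Let $m_i:=\prod_{k=1}^{i}\int_0^\infty\gamma_k(u)\,du$ (so $m_0=1$). Let $(A_1,A_2,A_3,A_4)$ be a partition of $\{0,1,2,\dots\}$ (parts may be empty), and for $\tau>0$ put $N_k(\tau)=\sum_{n\in A_k}N^n(0,\tau]$, $X^1_\tau=N_1(\tau)-N_2(\tau)$, $X^2_\tau=N_3(\tau)-N_4(\tau)$. **The functions $\rho$.** Define $\rho(i,j,x)\in[0,\infty]$,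 $i,j\ge0$, $x\in\mathbb{R}\setminus\{0\}$, recursively as follows. 1. $\rho(i,i,-x)=\rho(i,i,x)$, and $\rho(j,i,x)=\rho(i,j,-x)$ for all $i,j$. 2. $\rho(0,0,t-s)=\overline\gamma_0^2$ for $t>s$, and for $i\ge1$, $t>s$, $$\rho(i,i,t-s)=\int_{-\infty}^{s}\int_{-\infty}^{t}\gamma_i(t-u)\gamma_i(s-v)\rho(i-1,i-1,|u-v|)\,du\,dv+\int_{-\infty}^{s}\gamma_i(t-u)\gamma_i(s-u)\overline\gamma_0m_{i-1}\,du .$$ 3. For $i\ge0$, $$\rho(i,i+1,t-s)=\begin{cases}\int_{-\infty}^{s}\gamma_{i+1}(s-u)\rho(i,i,t-u)\,du,& t>s,\\[2pt] \int_{-\infty}^{s}\gamma_{i+1}(s-u)\rho(i,i,t-u)\,du+\gamma_{i+1}(s-t)\overline\gamma_0m_i,& t<s.\end{cases}$$ 4. For $j\ge i+2$ and all $t\ne s$, $\ \rho(i,j,t-s)=\int_{-\infty}^{s}\gamma_j(s-u)\rho(i,j-1,t-u)\,du$. **Proposition.** The functions $\rho(i,j,\cdot)$ are finite almost everywhere and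 are the second-order densities of the generations: for all $i,j\ge0$ and Borel sets $B,C\subseteq\mathbb{R}$, with values in $[0,\infty]$, $$\mathbb{E}[N^i(B)N^j(C)]=\int_B\int_C\rho(i,j,t-s)\,ds\,dt+\mathbf{1}_{\{i=j\}}\,\overline\gamma_0m_i\,|B\cap C| .$$ For every $\tau>0$, almost surely $\sum_{n\ge0}N^n(0,\tau]<\infty$; the variables $X^1_\tau$ and $X^2_\tau$ are square integrable; all the series below converge absolutely (indeed $\sum_{i\ge0}\overline\gamma_0m_i\tau<\infty$ and $\sum_{i,j\ge0}I_{ij}<\infty$); and, writing $I_{ij}=\int_0^\tau\int_0^\tau\rho(i,j,s-u)\,ds\,du$, $$\mathbb{E}[(X^1_\tau)^2]=\sum_{i\in A_1}\overline\gamma_0m_i\tau+\sum_{i,j\in A_1}I_{ij}+\sum_{i\in A_2}\overline\gamma_0m_i\tau+\sum_{i,j\in A_2}I_{ij}-2\sum_{i\in A_1,j\in A_2}I_{ij},$$ $$\mathbb{E}[(X^2_\tau)^2]=\sum_{i\in A_3}\overline\gamma_0m_i\tau+\sum_{i,j\in A_3}I_{ij}+\sum_{i\in A_4}\overline\gamma_0m_i\tau+\sum_{i,j\in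 A_4}I_{ij}-2\sum_{i\in A_3,j\in A_4}I_{ij},$$ $$\mathbb{E}[X^1_\tau X^2_\tau]=\sum_{i\in A_1,j\in A_3}I_{ij}+\sum_{i\in A_2,j\in A_4}I_{ij}-\sum_{i\in A_2,j\in A_3}I_{ij}-\sum_{i\in A_1,j\in A_4}I_{ij}.$$ -/

import Mathlib

open MeasureTheory ProbabilityTheory Set
open scoped ENNReal NNReal

noncomputable section

namespace HawkesGen

/-- The probability that a Poisson variable of mean `r ∈ [0, ∞]` takes the finite value `c`
(a Poisson variable of infinite mean is almost surely infinite). -/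
def poissonWeight (r : ℝ≥0∞) (c : ℕ) : ℝ≥0∞ :=
  if r = ∞ then 0 else poissonMeasure r.toNNReal {c}

/-- A simple, non-explosive (locally finite) point process on the real line: a random measure
each of whose realizations is the counting measure of a set of points that has only finitely many
elements in every bounded interval. -/
structure IsSimplePointProcess {Ω : Type*} [MeasurableSpace Ω] (M : Ω → Measure ℝ) : Prop where
  measurable : Measurable M
  simple : ∀ ω, ∃ S : Set ℝ, (∀ a b : ℝ, (S ∩ Icc a b).Finite) ∧
    M ω = Measure.count.restrict S

/-- Conditionally on the σ-algebra `𝓖`, the point process `M` is an inhomogeneous Poisson process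
on the real line with intensity `lam ω t` at time `t`: given `𝓖`, the numbers of points in
disjoint bounded Borel sets `B l` are independent Poisson variables of means
`∫_{B l} lam ω t dt`. -/
def IsCondPoisson {Ω : Type*} [MeasurableSpace Ω] (P : Measure Ω) (𝓖 : MeasurableSpace Ω)
    (M : Ω → Measure ℝ) (lam : Ω → ℝ → ℝ≥0∞) : Prop :=
  ∀ (k : ℕ) (B : Fin k → Set ℝ) (c : Fin k → ℕ),
    (∀ l, MeasurableSet (B l)) → (∀ l, Bornology.IsBounded (B l)) →
    Pairwise (fun l l' => Disjoint (B l) (B l')) →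
    ∀ E : Set Ω, MeasurableSet[𝓖] E →
      P (E ∩ {ω | ∀ l, M ω (B l) = (c l : ℝ≥0∞)}) =
        ∫⁻ ω in E, ∏ l, poissonWeight (∫⁻ t in B l, lam ω t) (c l) ∂P

/-- The σ-algebra generated by the generations `N 0, …, N n`. -/
@[reducible] def history {Ω : Type*} (N : ℕ → Ω → Measure ℝ) (n : ℕ) : MeasurableSpace Ω :=
  ⨆ k : ℕ, ⨆ _ : k ≤ n, MeasurableSpace.comap (N k) inferInstance

/-- The intensity `∫_{(-∞, t)} γ_{n+1}(t - s) N^n(ds)` of generation `n + 1`. -/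
def intensity {Ω : Type*} (γ : ℕ → ℝ → ℝ≥0) (N : ℕ → Ω → Measure ℝ) (n : ℕ)
    (ω : Ω) (t : ℝ) : ℝ≥0∞ :=
  ∫⁻ s in Iio t, (γ (n + 1) (t - s) : ℝ≥0∞) ∂(N n ω)

/-- The generations `N 0, N 1, …` of the stationary Hawkes process on the whole real line with
immigration rate `g₀` and exciting functions `γ 1, γ 2, …` (only the values `γ n t`, `n ≥ 1`,
`t > 0`, are used): the immigrants form a homogeneous Poisson process of rate `g₀`, and,
conditionally on generations `0, …, n`, generation `n + 1` is an inhomogeneous Poisson process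
with intensity `intensity γ N n`. -/
structure IsStationaryHawkes {Ω : Type*} [MeasurableSpace Ω] (P : Measure Ω) (g₀ : ℝ≥0)
    (γ : ℕ → ℝ → ℝ≥0) (N : ℕ → Ω → Measure ℝ) : Prop where
  pointProcess : ∀ n, IsSimplePointProcess (N n)
  immigrants : IsCondPoisson P ⊥ (N 0) (fun _ _ => (g₀ : ℝ≥0∞))
  offspring : ∀ n, IsCondPoisson P (history N n) (N (n + 1)) (intensity γ N n)

/-- `m_i = ∏_{k=1}^{i} ∫_0^∞ γ_k(u) du`, so `m_0 = 1`; the mean rate of generation `i` is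
`g₀ * m_i`. -/
def m (γ : ℕ → ℝ → ℝ≥0) (i : ℕ) : ℝ≥0∞ :=
  ∏ k ∈ Finset.Icc 1 i, ∫⁻ u in Ioi (0 : ℝ), (γ k u : ℝ≥0∞)

/-- The functions `ρ(i, i, x)`, which are even in `x`. -/
def rhoDiag (g₀ : ℝ≥0) (γ : ℕ → ℝ → ℝ≥0) : ℕ → ℝ → ℝ≥0∞
  | 0, _ => (g₀ : ℝ≥0∞) ^ 2
  | i + 1, x =>
      (∫⁻ v in Iio (0 : ℝ), ∫⁻ u in Iio |x|,
        (γ (i + 1) (|x| - u) : ℝ≥0∞) * γ (i + 1) (0 - v) * rhoDiag g₀ γ i |u - v|) +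
      ∫⁻ u in Iio (0 : ℝ), (γ (i + 1) (|x| - u) : ℝ≥0∞) * γ (i + 1) (0 - u) * (g₀ * m γ i)

/-- The functions `ρ(i, i + d, x)`, `d ≥ 0`. -/
def rhoUp (g₀ : ℝ≥0) (γ : ℕ → ℝ → ℝ≥0) (i : ℕ) : ℕ → ℝ → ℝ≥0∞
  | 0, x => rhoDiag g₀ γ i x
  | d + 1, x =>
      (∫⁻ u in Iio (0 : ℝ), (γ (i + d + 1) (0 - u) : ℝ≥0∞) * rhoUp g₀ γ i d (x - u)) +
      if d = 0 ∧ x < 0 then (γ (i + 1) (0 - x) : ℝ≥0∞) * (g₀ * m γ i) else 0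

/-- The recursively defined functions `ρ(i, j, x)`, with values in `[0, ∞]`; for `i > j` they are
given by `ρ(i, j, x) = ρ(j, i, -x)`. -/
def rho (g₀ : ℝ≥0) (γ : ℕ → ℝ → ℝ≥0) (i j : ℕ) (x : ℝ) : ℝ≥0∞ :=
  if i ≤ j then rhoUp g₀ γ i (j - i) x else rhoUp g₀ γ j (i - j) (-x)

/-- `∑_{n ∈ A} N^n(0, τ]`. -/
def groupCount {Ω : Type*} (N : ℕ → Ω → Measure ℝ) (A : Set ℕ) (τ : ℝ) (ω : Ω) : ℝ≥0∞ :=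
  ∑' n : A, N n ω (Ioc 0 τ)

/-- The difference `∑_{n ∈ A} N^n(0, τ] - ∑_{n ∈ B} N^n(0, τ]`. -/
def price {Ω : Type*} (N : ℕ → Ω → Measure ℝ) (A B : Set ℕ) (τ : ℝ) (ω : Ω) : ℝ :=
  (groupCount N A τ ω).toReal - (groupCount N B τ ω).toReal

/-- `∑_{i ∈ A} g₀ m_i τ`. -/
def firstOrderSum (g₀ : ℝ≥0) (γ : ℕ → ℝ → ℝ≥0) (A : Set ℕ) (τ : ℝ) : ℝ≥0∞ :=
  ∑' i : A, g₀ * m γ i * ENNReal.ofReal τ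

/-- `∑_{i ∈ A, j ∈ B} ∫_0^τ ∫_0^τ ρ(i, j, s - u) ds du`. -/
def secondOrderSum (g₀ : ℝ≥0) (γ : ℕ → ℝ → ℝ≥0) (A B : Set ℕ) (τ : ℝ) : ℝ≥0∞ :=
  ∑' i : A, ∑' j : B, ∫⁻ u in Ioc 0 τ, ∫⁻ s in Ioc 0 τ, rho g₀ γ i j (s - u)

end HawkesGen

end

/-! Two moment formulas carry the proof. Let `M` be conditionally Poisson given `𝓖` with intensity
`λ`. Then `E[Z ∫ g dM] = E[Z ∫ gλ dt]` for `𝓖`-measurable `Z` (`lintegral_mul_lintegral`), and `E[∫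
f dM ∫ g dM] = E[∫ fλ dt ∫ gλ dt + ∫ fgλ dt]` (`lintegral_lintegral_mul_lintegral`), where the last
term counts each point paired with itself. Both are derived from the law of the counts on bounded
sets, with values in `[0, ∞]`, so no integrability is assumed.

The intensity of generation `n + 1` is an integral of `γ (n + 1)` against generation `n`. By
Tonelli, a moment of generation `n + 1` is therefore a moment of generation `n` tested against
shifted copies of `γ (n + 1)` (`lintegral_mul_compensator`). Induction on the generation, over all
test functions at once, then reproduces the recursions for `ρ`: the diagonal one comes from the
second formula, the one in `j > i` from the first.

For finiteness, let `q < 1` bound the total masses of the exciting functions. Since `ρ(0, 0, ·)` is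
constant, it is not integrable on the line unless it vanishes, so one controls integrals over all
windows of a fixed length instead. Convolution multiplies such a bound by the mass of the kernel,
which leads to `K * q ^ max i j`, summable over `i` and `j`. The group counts are then square
integrable, and the moments of the prices follow by bilinear expansion. -/

namespace HawkesGen

/-! ### Moments of the Poisson law. -/

section PoissonMoments

variable {r : ℝ≥0∞}

theorem tsum_poissonWeight (hr : r ≠ ∞) : ∑' c, poissonWeight r c = 1 := by
  simp only [poissonWeight, hr, if_false]
  have h := lintegral_countable' (μ := poissonMeasure r.toNNReal) (fun _ => (1 : ℝ≥0∞))
  simpa using h.symm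

/-- Size-biasing: weighting a Poisson law by its value shifts it by one and produces a factor `r`.
Both moments below follow by applying this termwise. -/
theorem succ_mul_poissonWeight_succ (hr : r ≠ ∞) (c : ℕ) :
    ((c + 1 : ℕ) : ℝ≥0∞) * poissonWeight r (c + 1) = r * poissonWeight r c := by
  lift r to ℝ≥0 using hr
  simp only [poissonWeight, ENNReal.coe_ne_top, if_false, poissonMeasure_singleton,
    ENNReal.toNNReal_coe]
  rw [← ENNReal.ofReal_natCast, ← ENNReal.ofReal_mul (by positivity),
    ← ENNReal.ofReal_coe_nnreal, ← ENNReal.ofReal_mul (by positivity)]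
  congr 1
  rw [Nat.factorial_succ]
  push_cast
  field_simp
  ring

theorem tsum_mul_poissonWeight (hr : r ≠ ∞) : ∑' c : ℕ, (c : ℝ≥0∞) * poissonWeight r c = r := by
  rw [tsum_eq_zero_add' ENNReal.summable]
  simp_rw [succ_mul_poissonWeight_succ hr, ENNReal.tsum_mul_left, tsum_poissonWeight hr]
  simp

theorem tsum_sq_mul_poissonWeight (hr : r ≠ ∞) :
    ∑' c : ℕ, (c : ℝ≥0∞) ^ 2 * poissonWeight r c = r ^ 2 + r := by
  rw [tsum_eq_zero_add' ENNReal.summable]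
  simp_rw [sq ((_ : ℕ) : ℝ≥0∞), mul_assoc, succ_mul_poissonWeight_succ hr]
  have : ∀ c : ℕ, ((c + 1 : ℕ) : ℝ≥0∞) * (r * poissonWeight r c) =
      r * (c * poissonWeight r c) + r * poissonWeight r c := by
    intro c; push_cast; ring
  simp_rw [this]
  rw [ENNReal.summable.tsum_add ENNReal.summable, ENNReal.tsum_mul_left, ENNReal.tsum_mul_left,
    tsum_mul_poissonWeight hr, tsum_poissonWeight hr]
  simp [sq]

theorem measurable_poissonWeight (c : ℕ) : Measurable (fun r : ℝ≥0∞ => poissonWeight r c) := by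
  unfold poissonWeight
  refine Measurable.ite (measurableSet_singleton _) measurable_const ?_
  simp only [poissonMeasure_singleton]
  fun_prop

end PoissonMoments

/-- Two measures on the line that agree on the bounded Borel sets are equal. -/
theorem measure_ext_of_bounded {μ ν : Measure ℝ}
    (h : ∀ B, MeasurableSet B → Bornology.IsBounded B → μ B = ν B) : μ = ν := by
  ext B hB
  have hU : B = ⋃ n : ℕ, B ∩ Icc (-(n : ℝ)) n := by
    rw [← inter_iUnion]
    refine (inter_eq_left.2 fun x _ => ?_).symm
    obtain ⟨n, hn⟩ := exists_nat_ge |x|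
    exact mem_iUnion.2 ⟨n, abs_le.1 hn⟩
  -- Continuity from below along an exhaustion is enough, so neither measure has to be σ-finite.
  -- This matters because mean measures are compared before they are known to be finite.
  have hmono : Monotone fun n : ℕ => B ∩ Icc (-(n : ℝ)) n := by
    intro a b hab
    have : (a : ℝ) ≤ b := by exact_mod_cast hab
    exact inter_subset_inter_right _ (Icc_subset_Icc (by linarith) this)
  rw [hU, hmono.measure_iUnion, hmono.measure_iUnion]
  congr 1 with n
  exact h _ (hB.inter measurableSet_Icc) ((Metric.isBounded_Icc _ _).subset inter_subset_right)

/-! ### Random measures and compensators. -/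

variable {Ω : Type*}

theorem IsSimplePointProcess.exists_nat [MeasurableSpace Ω] {M : Ω → Measure ℝ}
    (hM : IsSimplePointProcess M) (ω : Ω)
    {B : Set ℝ} (hB : MeasurableSet B) (hb : Bornology.IsBounded B) :
    ∃ c : ℕ, M ω B = c := by
  obtain ⟨S, hS, hMS⟩ := hM.simple ω
  obtain ⟨R, hR⟩ := hb.subset_closedBall 0
  have hfin : (B ∩ S).Finite := by
    refine (hS (0 - R) (0 + R)).subset fun x hx => ⟨hx.2, ?_⟩
    have := hR hx.1
    rwa [Real.closedBall_eq_Icc] at this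
  refine ⟨hfin.toFinset.card, ?_⟩
  rw [hMS, Measure.restrict_apply hB, Measure.count_apply_finite _ hfin]

theorem measurable_measure_apply [MeasurableSpace Ω] {M : Ω → Measure ℝ} (hM : Measurable M)
    {B : Set ℝ} (hB : MeasurableSet B) : Measurable fun ω => M ω B :=
  (Measure.measurable_coe hB).comp hM

theorem measurable_lintegral_measure [MeasurableSpace Ω] {M : Ω → Measure ℝ} (hM : Measurable M)
    {g : ℝ → ℝ≥0∞} (hg : Measurable g) : Measurable fun ω => ∫⁻ t, g t ∂(M ω) :=
  (Measure.measurable_lintegral hg).comp hM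

theorem lintegral_withDensity_mul {α : Type*} [MeasurableSpace α] {μ : Measure α}
    {f g : α → ℝ≥0∞} (hf : Measurable f) (hg : Measurable g) :
    ∫⁻ a, g a ∂(μ.withDensity f) = ∫⁻ a, f a * g a ∂μ :=
  lintegral_withDensity_eq_lintegral_mul _ hf hg

/-- The measure with the random density `lam ω`. -/
noncomputable def compensator (lam : Ω → ℝ → ℝ≥0∞) (ω : Ω) : Measure ℝ :=
  volume.withDensity (lam ω)

theorem compensator_apply (lam : Ω → ℝ → ℝ≥0∞) (ω : Ω) {B : Set ℝ} (hB : MeasurableSet B) :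
    compensator lam ω B = ∫⁻ t in B, lam ω t := withDensity_apply _ hB

theorem measurable_compensator [MeasurableSpace Ω] {lam : Ω → ℝ → ℝ≥0∞}
    (hlam : Measurable (Function.uncurry lam)) : Measurable (compensator lam) := by
  refine Measure.measurable_of_measurable_coe _ fun B hB => ?_
  simp_rw [compensator_apply lam _ hB]
  exact hlam.lintegral_prod_right'

theorem lintegral_compensator [MeasurableSpace Ω] {lam : Ω → ℝ → ℝ≥0∞}
    (hlam : Measurable (Function.uncurry lam)) (ω : Ω) {g : ℝ → ℝ≥0∞} (hg : Measurable g) :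
    ∫⁻ t, g t ∂(compensator lam ω) = ∫⁻ t, g t * lam ω t := by
  have hl : Measurable (lam ω) := hlam.comp measurable_prodMk_left
  rw [compensator, lintegral_withDensity_mul hl hg]
  exact lintegral_congr fun t => mul_comm _ _

/-! ### Moment formulas for conditional Poisson processes. -/

namespace IsCondPoisson

variable {𝓖 : MeasurableSpace Ω} [mΩ : MeasurableSpace Ω] {P : Measure Ω}
  {M : Ω → Measure ℝ} {lam : Ω → ℝ → ℝ≥0∞}

theorem measure_inter_eq (h : IsCondPoisson P 𝓖 M lam) {B : Set ℝ} (hB : MeasurableSet B)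
    (hb : Bornology.IsBounded B) (c : ℕ) {E : Set Ω} (hE : MeasurableSet[𝓖] E) :
    P (E ∩ {ω | M ω B = c}) = ∫⁻ ω in E, poissonWeight (compensator lam ω B) c ∂P := by
  have := h 1 (fun _ => B) (fun _ => c) (fun _ => hB) (fun _ => hb)
    (fun i j hij => (hij (Subsingleton.elim i j)).elim) E hE
  simpa [compensator_apply _ _ hB] using this

theorem measure_pair_eq (h : IsCondPoisson P 𝓖 M lam) {B C : Set ℝ} (hB : MeasurableSet B)
    (hb : Bornology.IsBounded B) (hC : MeasurableSet C) (hc : Bornology.IsBounded C)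
    (hBC : Disjoint B C) (b c : ℕ) :
    P {ω | M ω B = b ∧ M ω C = c} =
      ∫⁻ ω, poissonWeight (compensator lam ω B) b * poissonWeight (compensator lam ω C) c ∂P := by
  have := h 2 ![B, C] ![b, c] (by simp [Fin.forall_fin_two, hB, hC])
    (by simp [Fin.forall_fin_two, hb, hc])
    (by
      intro i j hij
      fin_cases i <;> fin_cases j <;> simp_all [disjoint_comm]) univ (@MeasurableSet.univ _ 𝓖)
  simpa [compensator_apply _ _ hB, compensator_apply _ _ hC, Fin.forall_fin_two] using this

/-- Counts on bounded sets are natural numbers, so any function of a count is a countable sum over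
its level sets, whose probabilities are prescribed. -/
theorem setLIntegral_comp_count (h : IsCondPoisson P 𝓖 M lam)
    (hM : IsSimplePointProcess M) (hlam : Measurable (Function.uncurry lam))
    {B : Set ℝ} (hB : MeasurableSet B) (hb : Bornology.IsBounded B)
    (F : ℝ≥0∞ → ℝ≥0∞) {E : Set Ω} (hE : MeasurableSet[𝓖] E) :
    ∫⁻ ω in E, F (M ω B) ∂P =
      ∫⁻ ω in E, ∑' c : ℕ, F c * poissonWeight (compensator lam ω B) c ∂P := by
  have hMB : Measurable fun ω => M ω B := measurable_measure_apply hM.measurable hB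
  have hLB : ∀ c, Measurable fun ω => poissonWeight (compensator lam ω B) c := fun c =>
    (measurable_poissonWeight c).comp (measurable_measure_apply (measurable_compensator hlam) hB)
  have hms : ∀ c : ℕ, MeasurableSet {ω | M ω B = c} := fun c => hMB (measurableSet_singleton _)
  have hpt : ∀ ω, F (M ω B) = ∑' c : ℕ, {ω | M ω B = c}.indicator (fun _ => F c) ω := by
    intro ω
    obtain ⟨n, hn⟩ := hM.exists_nat ω hB hb
    rw [tsum_eq_single n]
    · simp [indicator, hn]
    · intro c hc
      simp [indicator, hn, hc.symm]
  simp_rw [hpt]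
  rw [lintegral_tsum fun c => (measurable_const.indicator (hms c)).aemeasurable,
    lintegral_tsum fun c => ((hLB c).const_mul _).aemeasurable]
  congr 1 with c
  rw [lintegral_indicator_const (hms c), lintegral_const_mul _ (hLB c),
    Measure.restrict_apply (hms c), inter_comm, h.measure_inter_eq hB hb c hE]

/-- The weights sum to `1` when the mean is finite and to `0` when it is infinite. Since the count
is always finite, the total mass `1` forces the mean to be finite almost surely. -/
theorem ae_compensator_ne_top [IsProbabilityMeasure P] (h : IsCondPoisson P 𝓖 M lam)
    (hM : IsSimplePointProcess M) (hlam : Measurable (Function.uncurry lam))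
    {B : Set ℝ} (hB : MeasurableSet B) (hb : Bornology.IsBounded B) :
    ∀ᵐ ω ∂P, compensator lam ω B ≠ ∞ := by
  have hLB : Measurable fun ω => compensator lam ω B :=
    (Measure.measurable_coe hB).comp (measurable_compensator hlam)
  have hms : MeasurableSet {ω | compensator lam ω B ≠ ∞} :=
    hLB (measurableSet_singleton ∞).compl
  have key := h.setLIntegral_comp_count hM hlam hB hb (fun _ => 1) (@MeasurableSet.univ _ 𝓖)
  have hpt : ∀ ω, ∑' c : ℕ, 1 * poissonWeight (compensator lam ω B) c =
      {ω | compensator lam ω B ≠ ∞}.indicator (fun _ => 1) ω := by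
    intro ω
    by_cases hω : compensator lam ω B = ∞
    · simp [hω, poissonWeight]
    · simp [hω, tsum_poissonWeight]
  simp_rw [hpt] at key
  rw [setLIntegral_univ, setLIntegral_univ, lintegral_indicator_const hms] at key
  simp only [lintegral_const, measure_univ, one_mul, mul_one] at key
  exact (mem_ae_iff_prob_eq_one hms).2 key.symm

variable [IsProbabilityMeasure P]

theorem setLIntegral_count (h : IsCondPoisson P 𝓖 M lam)
    (hM : IsSimplePointProcess M) (hlam : Measurable (Function.uncurry lam))
    {B : Set ℝ} (hB : MeasurableSet B) (hb : Bornology.IsBounded B)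
    {E : Set Ω} (hE : MeasurableSet[𝓖] E) :
    ∫⁻ ω in E, M ω B ∂P = ∫⁻ ω in E, compensator lam ω B ∂P := by
  rw [h.setLIntegral_comp_count hM hlam hB hb (fun x => x) hE]
  refine lintegral_congr_ae (ae_restrict_of_ae ?_)
  filter_upwards [h.ae_compensator_ne_top hM hlam hB hb] with ω hω
  exact tsum_mul_poissonWeight hω

theorem lintegral_count_sq (h : IsCondPoisson P 𝓖 M lam)
    (hM : IsSimplePointProcess M) (hlam : Measurable (Function.uncurry lam))
    {B : Set ℝ} (hB : MeasurableSet B) (hb : Bornology.IsBounded B) :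
    ∫⁻ ω, M ω B ^ 2 ∂P = ∫⁻ ω, compensator lam ω B ^ 2 + compensator lam ω B ∂P := by
  have := h.setLIntegral_comp_count hM hlam hB hb (fun x => x ^ 2) (@MeasurableSet.univ _ 𝓖)
  rw [setLIntegral_univ, setLIntegral_univ] at this
  rw [this]
  refine lintegral_congr_ae ?_
  filter_upwards [h.ae_compensator_ne_top hM hlam hB hb] with ω hω
  exact tsum_sq_mul_poissonWeight hω

theorem lintegral_count_mul_of_disjoint (h : IsCondPoisson P 𝓖 M lam)
    (hM : IsSimplePointProcess M) (hlam : Measurable (Function.uncurry lam))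
    {B C : Set ℝ} (hB : MeasurableSet B) (hb : Bornology.IsBounded B)
    (hC : MeasurableSet C) (hc : Bornology.IsBounded C) (hBC : Disjoint B C) :
    ∫⁻ ω, M ω B * M ω C ∂P = ∫⁻ ω, compensator lam ω B * compensator lam ω C ∂P := by
  have hMB : ∀ {D}, MeasurableSet D → Measurable fun ω => M ω D :=
    fun hD => measurable_measure_apply hM.measurable hD
  have hLB : ∀ {D} (c : ℕ), MeasurableSet D →
      Measurable fun ω => poissonWeight (compensator lam ω D) c :=
    fun c hD => (measurable_poissonWeight c).comp
      ((Measure.measurable_coe hD).comp (measurable_compensator hlam))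
  have hms : ∀ p : ℕ × ℕ, MeasurableSet {ω | M ω B = p.1 ∧ M ω C = p.2} := fun p =>
    (hMB hB (measurableSet_singleton _)).inter (hMB hC (measurableSet_singleton _))
  have hpt : ∀ ω, M ω B * M ω C = ∑' p : ℕ × ℕ,
      {ω | M ω B = p.1 ∧ M ω C = p.2}.indicator (fun _ => (p.1 : ℝ≥0∞) * p.2) ω := by
    intro ω
    obtain ⟨a, ha⟩ := hM.exists_nat ω hB hb
    obtain ⟨b, hb⟩ := hM.exists_nat ω hC hc
    rw [tsum_eq_single (a, b)]
    · simp [indicator, ha, hb]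
    · rintro ⟨c, d⟩ hne
      refine indicator_of_notMem ?_ _
      rintro ⟨h1, h2⟩
      rw [ha] at h1
      rw [hb] at h2
      exact hne (by rw [Nat.cast_injective h1, Nat.cast_injective h2])
  simp_rw [hpt]
  rw [lintegral_tsum fun p => (measurable_const.indicator (hms p)).aemeasurable]
  have : ∀ᵐ ω ∂P, compensator lam ω B * compensator lam ω C = ∑' p : ℕ × ℕ,
      ((p.1 : ℝ≥0∞) * p.2) *
        (poissonWeight (compensator lam ω B) p.1 * poissonWeight (compensator lam ω C) p.2) := by
    filter_upwards [h.ae_compensator_ne_top hM hlam hB hb,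
      h.ae_compensator_ne_top hM hlam hC hc] with ω h1 h2
    rw [ENNReal.tsum_prod']
    have e : ∀ a b : ℕ, ((a : ℝ≥0∞) * b) *
        (poissonWeight (compensator lam ω B) a * poissonWeight (compensator lam ω C) b) =
        (a * poissonWeight (compensator lam ω B) a) *
          (b * poissonWeight (compensator lam ω C) b) := fun a b => mul_mul_mul_comm _ _ _ _
    simp only [e, ENNReal.tsum_mul_left, ENNReal.tsum_mul_right,
      tsum_mul_poissonWeight h1, tsum_mul_poissonWeight h2]
  have hW : ∀ p : ℕ × ℕ, Measurable fun ω =>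
      poissonWeight (compensator lam ω B) p.1 * poissonWeight (compensator lam ω C) p.2 :=
    fun p => (hLB p.1 hB).fun_mul (hLB p.2 hC)
  refine Eq.trans ?_ (lintegral_congr_ae this).symm
  rw [lintegral_tsum fun p => ((hW p).const_mul _).aemeasurable]
  refine tsum_congr fun p => ?_
  rw [lintegral_indicator_const (hms p), lintegral_const_mul _ (hW p),
    h.measure_pair_eq hB hb hC hc hBC]

/-- Split along `B \ C`, `C \ B` and `B ∩ C`. Conditional independence handles the products over
disjoint pieces; only the square over `B ∩ C` contributes an extra mean. -/
theorem lintegral_count_mul (h : IsCondPoisson P 𝓖 M lam)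
    (hM : IsSimplePointProcess M) (hlam : Measurable (Function.uncurry lam))
    {B C : Set ℝ} (hB : MeasurableSet B) (hb : Bornology.IsBounded B)
    (hC : MeasurableSet C) (hc : Bornology.IsBounded C) :
    ∫⁻ ω, M ω B * M ω C ∂P =
      ∫⁻ ω, (compensator lam ω B * compensator lam ω C + compensator lam ω (B ∩ C)) ∂P := by
  have hMB : ∀ {D}, MeasurableSet D → Measurable fun ω => M ω D :=
    fun hD => measurable_measure_apply hM.measurable hD
  have hLB : ∀ {D}, MeasurableSet D → Measurable fun ω => compensator lam ω D :=
    fun hD => (Measure.measurable_coe hD).comp (measurable_compensator hlam)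
  have hI := hB.inter hC
  have hi : Bornology.IsBounded (B ∩ C) := hb.subset inter_subset_left
  have hBd := hB.diff hC
  have hbd : Bornology.IsBounded (B \ C) := hb.subset sdiff_subset
  have hCd := hC.diff hB
  have hcd : Bornology.IsBounded (C \ B) := hc.subset sdiff_subset
  have expand : ∀ μ : Measure ℝ, μ B * μ C = μ (B \ C) * μ (C \ B) + μ (B \ C) * μ (B ∩ C) +
      μ (C \ B) * μ (B ∩ C) + μ (B ∩ C) ^ 2 := by
    intro μ
    rw [← measure_inter_add_sdiff B hC, ← measure_inter_add_sdiff C hB, inter_comm C B]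
    ring
  have e1 := h.lintegral_count_mul_of_disjoint hM hlam hBd hbd hCd hcd
    (disjoint_sdiff_sdiff)
  have e2 := h.lintegral_count_mul_of_disjoint hM hlam hBd hbd hI hi
    (disjoint_left.2 fun x hx hx' => hx.2 hx'.2)
  have e3 := h.lintegral_count_mul_of_disjoint hM hlam hCd hcd hI hi
    (disjoint_left.2 fun x hx hx' => hx.2 hx'.1)
  have e4 := h.lintegral_count_sq hM hlam hI hi
  simp_rw [expand, add_assoc]
  rw [lintegral_add_left ((hMB hBd).fun_mul (hMB hCd)), lintegral_add_left ((hMB hBd).fun_mul (hMB hI)),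
    lintegral_add_left ((hMB hCd).fun_mul (hMB hI)), e1, e2, e3, e4,
    lintegral_add_left ((hLB hBd).fun_mul (hLB hCd)), lintegral_add_left ((hLB hBd).fun_mul (hLB hI)),
    lintegral_add_left ((hLB hCd).fun_mul (hLB hI))]

/-- The first moment: the conditional mean measure of `M` is its compensator. -/
theorem lintegral_mul_lintegral (h : IsCondPoisson P 𝓖 M lam) (h𝓖 : 𝓖 ≤ mΩ)
    (hM : IsSimplePointProcess M) (hlam : Measurable (Function.uncurry lam))
    {Z : Ω → ℝ≥0∞} (hZ : Measurable[𝓖] Z) {g : ℝ → ℝ≥0∞} (hg : Measurable g) :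
    ∫⁻ ω, Z ω * ∫⁻ t, g t ∂(M ω) ∂P = ∫⁻ ω, Z ω * ∫⁻ t, g t ∂(compensator lam ω) ∂P := by
  have hZ' : Measurable Z := hZ.mono h𝓖 le_rfl
  have hL := measurable_compensator hlam
  -- Both sides, as functionals of `g`, are integrals against measures on the line, so it suffices
  -- to compare these on bounded Borel sets.
  have key : (P.withDensity Z).bind M = (P.withDensity Z).bind (compensator lam) := by
    refine measure_ext_of_bounded fun B hB hb => ?_
    have hMB : Measurable fun ω => M ω B := measurable_measure_apply hM.measurable hB
    have hLB : Measurable fun ω => compensator lam ω B := measurable_measure_apply hL hB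
    rw [Measure.bind_apply hB hM.measurable.aemeasurable, Measure.bind_apply hB hL.aemeasurable,
      lintegral_withDensity_mul hZ' hMB,
      lintegral_withDensity_mul hZ' hLB]
    -- The same device extends events of `𝓖` to `𝓖`-measurable weights `Z`: the two measures agree
    -- on `𝓖`, hence integrate `Z` alike.
    have e : (P.withDensity fun ω => M ω B).trim h𝓖 =
        (P.withDensity fun ω => compensator lam ω B).trim h𝓖 := by
      refine @Measure.ext _ 𝓖 _ _ fun E hE => ?_
      rw [trim_measurableSet_eq h𝓖 hE, trim_measurableSet_eq h𝓖 hE,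
        withDensity_apply _ (h𝓖 _ hE), withDensity_apply _ (h𝓖 _ hE)]
      exact h.setLIntegral_count hM hlam hB hb hE
    have e' : ∫⁻ ω, Z ω ∂((P.withDensity fun ω => M ω B).trim h𝓖) =
        ∫⁻ ω, Z ω ∂((P.withDensity fun ω => compensator lam ω B).trim h𝓖) := by rw [e]
    rw [lintegral_trim h𝓖 hZ, lintegral_trim h𝓖 hZ,
      lintegral_withDensity_mul hMB hZ',
      lintegral_withDensity_mul hLB hZ'] at e'
    simpa only [mul_comm (Z _)] using e'
  have := congrArg (fun μ => ∫⁻ t, g t ∂μ) key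
  beta_reduce at this
  rw [Measure.lintegral_bind hM.measurable.aemeasurable hg.aemeasurable,
    Measure.lintegral_bind hL.aemeasurable hg.aemeasurable,
    lintegral_withDensity_mul hZ'
      (measurable_lintegral_measure hM.measurable hg),
    lintegral_withDensity_mul hZ' (measurable_lintegral_measure hL hg)] at this
  exact this

/-- Polarization one variable at a time: with `B` fixed, equality on all bounded `C` is an equality
of measures and extends to `g`. The next theorem repeats this for `B`. -/
theorem lintegral_count_mul_lintegral (h : IsCondPoisson P 𝓖 M lam)
    (hM : IsSimplePointProcess M) (hlam : Measurable (Function.uncurry lam))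
    {B : Set ℝ} (hB : MeasurableSet B) (hb : Bornology.IsBounded B)
    {g : ℝ → ℝ≥0∞} (hg : Measurable g) :
    ∫⁻ ω, M ω B * ∫⁻ t, g t ∂(M ω) ∂P =
      ∫⁻ ω, (compensator lam ω B * ∫⁻ t, g t ∂(compensator lam ω)) +
        ∫⁻ t in B, g t ∂(compensator lam ω) ∂P := by
  have hL := measurable_compensator hlam
  have hMB : Measurable fun ω => M ω B := measurable_measure_apply hM.measurable hB
  have hLB : Measurable fun ω => compensator lam ω B := measurable_measure_apply hL hB
  have hLr : Measurable fun ω => (compensator lam ω).restrict B :=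
    Measure.measurable_of_measurable_coe _ fun C hC => by
      simp_rw [Measure.restrict_apply hC]
      exact measurable_measure_apply hL (hC.inter hB)
  have key : (P.withDensity fun ω => M ω B).bind M =
      (P.withDensity fun ω => compensator lam ω B).bind (compensator lam) +
        P.bind (fun ω => (compensator lam ω).restrict B) := by
    refine measure_ext_of_bounded fun C hC hc => ?_
    rw [Measure.add_apply, Measure.bind_apply hC hM.measurable.aemeasurable,
      Measure.bind_apply hC hL.aemeasurable, Measure.bind_apply hC hLr.aemeasurable,
      lintegral_withDensity_mul hMB
        (measurable_measure_apply hM.measurable hC),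
      lintegral_withDensity_mul hLB (measurable_measure_apply hL hC),
      ← lintegral_add_left (hLB.fun_mul (measurable_measure_apply hL hC))]
    simp_rw [Measure.restrict_apply hC, inter_comm C B]
    exact h.lintegral_count_mul hM hlam hB hb hC hc
  have := congrArg (fun μ => ∫⁻ t, g t ∂μ) key
  beta_reduce at this
  rw [lintegral_add_measure, Measure.lintegral_bind hM.measurable.aemeasurable hg.aemeasurable,
    Measure.lintegral_bind hL.aemeasurable hg.aemeasurable,
    Measure.lintegral_bind hLr.aemeasurable hg.aemeasurable,
    lintegral_withDensity_mul hMB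
      (measurable_lintegral_measure hM.measurable hg),
    lintegral_withDensity_mul hLB (measurable_lintegral_measure hL hg),
    ← lintegral_add_left (hLB.fun_mul (measurable_lintegral_measure hL hg))] at this
  exact this

/-- The second moment of a conditional Poisson process. -/
theorem lintegral_lintegral_mul_lintegral (h : IsCondPoisson P 𝓖 M lam)
    (hM : IsSimplePointProcess M) (hlam : Measurable (Function.uncurry lam))
    {f g : ℝ → ℝ≥0∞} (hf : Measurable f) (hg : Measurable g) :
    ∫⁻ ω, (∫⁻ t, f t ∂(M ω)) * ∫⁻ t, g t ∂(M ω) ∂P =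
      ∫⁻ ω, ((∫⁻ t, f t ∂(compensator lam ω)) * ∫⁻ t, g t ∂(compensator lam ω)) +
        ∫⁻ t, f t * g t ∂(compensator lam ω) ∂P := by
  have hL := measurable_compensator hlam
  have hMg : Measurable fun ω => ∫⁻ t, g t ∂(M ω) :=
    measurable_lintegral_measure hM.measurable hg
  have hLg : Measurable fun ω => ∫⁻ t, g t ∂(compensator lam ω) :=
    measurable_lintegral_measure hL hg
  have hLd : Measurable fun ω => (compensator lam ω).withDensity g := by
    refine Measure.measurable_of_measurable_coe _ fun B hB => ?_
    have hLr : Measurable fun ω => (compensator lam ω).restrict B :=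
      Measure.measurable_of_measurable_coe _ fun C hC => by
        simp_rw [Measure.restrict_apply hC]
        exact measurable_measure_apply hL (hC.inter hB)
    simp_rw [withDensity_apply g hB]
    exact measurable_lintegral_measure hLr hg
  have key : (P.withDensity fun ω => ∫⁻ t, g t ∂(M ω)).bind M =
      (P.withDensity fun ω => ∫⁻ t, g t ∂(compensator lam ω)).bind (compensator lam) +
        P.bind (fun ω => (compensator lam ω).withDensity g) := by
    refine measure_ext_of_bounded fun B hB hb => ?_
    rw [Measure.add_apply, Measure.bind_apply hB hM.measurable.aemeasurable,
      Measure.bind_apply hB hL.aemeasurable, Measure.bind_apply hB hLd.aemeasurable,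
      lintegral_withDensity_mul hMg
        (measurable_measure_apply hM.measurable hB),
      lintegral_withDensity_mul hLg (measurable_measure_apply hL hB),
      ← lintegral_add_left (hLg.fun_mul (measurable_measure_apply hL hB))]
    simp_rw [withDensity_apply g hB]
    have := h.lintegral_count_mul_lintegral hM hlam hB hb hg
    simpa only [mul_comm] using this
  have := congrArg (fun μ => ∫⁻ t, f t ∂μ) key
  beta_reduce at this
  rw [lintegral_add_measure, Measure.lintegral_bind hM.measurable.aemeasurable hf.aemeasurable,
    Measure.lintegral_bind hL.aemeasurable hf.aemeasurable,
    Measure.lintegral_bind hLd.aemeasurable hf.aemeasurable,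
    lintegral_withDensity_mul hMg
      (measurable_lintegral_measure hM.measurable hf),
    lintegral_withDensity_mul hLg (measurable_lintegral_measure hL hf),
    ← lintegral_add_left (hLg.fun_mul (measurable_lintegral_measure hL hf))] at this
  simp_rw [lintegral_withDensity_mul hg hf] at this
  simpa only [mul_comm] using this

end IsCondPoisson

end HawkesGen

/-! ### The recursion for the densities as integrals over the whole line. -/

namespace HawkesGen

/-- The exciting function `γ n`, extended by zero to the nonpositive half-line. -/
noncomputable def excite (γ : ℕ → ℝ → ℝ≥0) (n : ℕ) (x : ℝ) : ℝ≥0∞ :=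
  if 0 < x then (γ n x : ℝ≥0∞) else 0

variable {g₀ : ℝ≥0} {γ : ℕ → ℝ → ℝ≥0}

theorem measurable_excite (hγ : ∀ n, 1 ≤ n → Measurable (γ n)) (n : ℕ) :
    Measurable (excite γ (n + 1)) :=
  Measurable.ite measurableSet_Ioi (hγ (n + 1) (by omega)).coe_nnreal_ennreal measurable_const

theorem lintegral_excite (n : ℕ) : ∫⁻ x, excite γ n x = ∫⁻ u in Ioi (0 : ℝ), (γ n u : ℝ≥0∞) := by
  rw [← lintegral_indicator measurableSet_Ioi]
  rfl

theorem lintegral_excite_sub_left (n : ℕ) (t : ℝ) :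
    ∫⁻ u, excite γ n (t - u) = ∫⁻ u in Ioi (0 : ℝ), (γ n u : ℝ≥0∞) := by
  rw [lintegral_sub_left_eq_self (excite γ n) t, lintegral_excite]

/-- Causality moves from the domain of integration into the kernel, which makes translation
invariance and Tonelli directly usable. The measure is general so that this also covers the random
measures `N n ω`. -/
theorem setLIntegral_Iio_mul (μ : Measure ℝ) (n : ℕ) (t : ℝ) (F : ℝ → ℝ≥0∞) :
    ∫⁻ u in Iio t, (γ n (t - u) : ℝ≥0∞) * F u ∂μ = ∫⁻ u, excite γ n (t - u) * F u ∂μ := by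
  rw [← lintegral_indicator measurableSet_Iio]
  refine lintegral_congr fun u => ?_
  by_cases h : u < t <;> simp [excite, h]

theorem intensity_eq {Ω : Type*} (N : ℕ → Ω → Measure ℝ) (n : ℕ) (ω : Ω) (t : ℝ) :
    intensity γ N n ω t = ∫⁻ s, excite γ (n + 1) (t - s) ∂(N n ω) := by
  unfold intensity
  simpa using setLIntegral_Iio_mul (γ := γ) (N n ω) (n + 1) t 1

theorem m_succ (i : ℕ) : m γ (i + 1) = m γ i * ∫⁻ x, excite γ (i + 1) x := by
  rw [m, Finset.prod_Icc_succ_top (by omega), lintegral_excite]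
  rfl

theorem rhoDiag_abs (i : ℕ) (x : ℝ) : rhoDiag g₀ γ i |x| = rhoDiag g₀ γ i x := by
  cases i <;> simp [rhoDiag]

theorem rhoDiag_neg (i : ℕ) (x : ℝ) : rhoDiag g₀ γ i (-x) = rhoDiag g₀ γ i x := by
  rw [← rhoDiag_abs, abs_neg, rhoDiag_abs]

theorem setLIntegral_Iio_Iio (n : ℕ) (t s : ℝ) (F : ℝ → ℝ → ℝ≥0∞) :
    ∫⁻ v in Iio s, ∫⁻ u in Iio t, (γ n (t - u) : ℝ≥0∞) * γ n (s - v) * F u v =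
      ∫⁻ v, ∫⁻ u, excite γ n (t - u) * excite γ n (s - v) * F u v := by
  have h1 : ∀ v, ∫⁻ u in Iio t, (γ n (t - u) : ℝ≥0∞) * γ n (s - v) * F u v =
      γ n (s - v) * ∫⁻ u, excite γ n (t - u) * F u v := by
    intro v
    rw [← setLIntegral_Iio_mul, ← lintegral_const_mul' _ _ ENNReal.coe_ne_top]
    exact lintegral_congr fun u => by ring
  have h2 : ∀ v, ∫⁻ u, excite γ n (t - u) * excite γ n (s - v) * F u v =
      excite γ n (s - v) * ∫⁻ u, excite γ n (t - u) * F u v := by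
    intro v
    rw [← lintegral_const_mul' _ _ (by unfold excite; split_ifs <;> simp)]
    exact lintegral_congr fun u => by ring
  simp_rw [h1, h2]
  exact setLIntegral_Iio_mul _ _ _ _

theorem setLIntegral_Iio_mul_mul (n : ℕ) {t s : ℝ} (hst : s ≤ t) (c : ℝ≥0∞) :
    ∫⁻ u in Iio s, (γ n (t - u) : ℝ≥0∞) * γ n (s - u) * c =
      ∫⁻ u, excite γ n (t - u) * excite γ n (s - u) * c := by
  rw [← lintegral_indicator measurableSet_Iio]
  refine lintegral_congr fun u => ?_
  by_cases h : u < s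
  · simp [excite, h, h.trans_le hst]
  · simp [excite, h]

theorem rhoDiag_succ (i : ℕ) (x : ℝ) :
    rhoDiag g₀ γ (i + 1) x =
      (∫⁻ v, ∫⁻ u, excite γ (i + 1) (|x| - u) * excite γ (i + 1) (-v) * rhoDiag g₀ γ i (u - v)) +
      ∫⁻ u, excite γ (i + 1) (|x| - u) * excite γ (i + 1) (-u) * (g₀ * m γ i) := by
  rw [rhoDiag, setLIntegral_Iio_Iio (i + 1) |x| 0 (fun u v => rhoDiag g₀ γ i |u - v|)]
  rw [setLIntegral_Iio_mul_mul (i + 1) (abs_nonneg x)]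
  simp_rw [rhoDiag_abs, zero_sub]

theorem measurable_rhoDiag (hγ : ∀ n, 1 ≤ n → Measurable (γ n)) (i : ℕ) :
    Measurable (rhoDiag g₀ γ i) := by
  induction i with
  | zero => exact measurable_const
  | succ i ih =>
    have hk := measurable_excite hγ i
    simp_rw [funext (rhoDiag_succ (g₀ := g₀) (γ := γ) i)]
    refine Measurable.add ?_ ?_
    · refine Measurable.lintegral_prod_right' (f := fun p : ℝ × ℝ => ∫⁻ u,
        excite γ (i + 1) (|p.1| - u) * excite γ (i + 1) (-p.2) * rhoDiag g₀ γ i (u - p.2)) ?_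
      exact Measurable.lintegral_prod_right' (f := fun p : (ℝ × ℝ) × ℝ =>
        excite γ (i + 1) (|p.1.1| - p.2) * excite γ (i + 1) (-p.1.2) *
          rhoDiag g₀ γ i (p.2 - p.1.2)) (by fun_prop)
    · exact Measurable.lintegral_prod_right' (f := fun p : ℝ × ℝ =>
        excite γ (i + 1) (|p.1| - p.2) * excite γ (i + 1) (-p.2) * (g₀ * m γ i)) (by fun_prop)

/-- The recursion for the diagonal densities, in a form that is symmetric in `t` and `s`. -/
theorem rhoDiag_succ_sub (hγ : ∀ n, 1 ≤ n → Measurable (γ n)) (i : ℕ) (t s : ℝ) :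
    rhoDiag g₀ γ (i + 1) (t - s) =
      (∫⁻ v, ∫⁻ u, excite γ (i + 1) (t - u) * excite γ (i + 1) (s - v) *
        rhoDiag g₀ γ i (u - v)) +
      ∫⁻ u, excite γ (i + 1) (t - u) * excite γ (i + 1) (s - u) * (g₀ * m γ i) := by
  -- Exchanging `t` and `s` amounts to exchanging `u` and `v`, by Tonelli and the evenness of the
  -- previous diagonal density.
  wlog hst : s ≤ t generalizing t s
  · rw [← rhoDiag_neg, neg_sub, this s t (le_of_not_ge hst)]
    have hk := measurable_excite hγ i
    have hr := measurable_rhoDiag (g₀ := g₀) hγ i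
    congr 1
    · rw [lintegral_lintegral_swap (by fun_prop)]
      refine lintegral_congr fun u => lintegral_congr fun v => ?_
      rw [← rhoDiag_neg, neg_sub]
      ring
    · exact lintegral_congr fun u => by ring
  rw [rhoDiag_succ, abs_of_nonneg (sub_nonneg.2 hst)]
  congr 1
  · rw [← lintegral_sub_right_eq_self _ s]
    refine lintegral_congr fun v => ?_
    rw [← lintegral_sub_right_eq_self _ s]
    refine lintegral_congr fun u => ?_
    rw [show t - s - (u - s) = t - u by ring, neg_sub, show u - s - (v - s) = u - v by ring]
  · rw [← lintegral_sub_right_eq_self _ s]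
    refine lintegral_congr fun u => ?_
    rw [show t - s - (u - s) = t - u by ring, neg_sub]

theorem rhoUp_succ_sub (i d : ℕ) (t s : ℝ) :
    rhoUp g₀ γ i (d + 1) (t - s) =
      (∫⁻ u, excite γ (i + d + 1) (s - u) * rhoUp g₀ γ i d (t - u)) +
      if d = 0 then excite γ (i + 1) (s - t) * (g₀ * m γ i) else 0 := by
  rw [rhoUp, setLIntegral_Iio_mul]
  congr 1
  · rw [← lintegral_sub_right_eq_self _ s]
    refine lintegral_congr fun u => ?_
    rw [zero_sub, neg_sub, sub_sub_sub_cancel_right]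
  · rw [zero_sub, neg_sub]
    by_cases h : t < s <;> by_cases hd : d = 0 <;> simp [excite, h, hd]

theorem rhoUp_succ (i d : ℕ) (x : ℝ) :
    rhoUp g₀ γ i (d + 1) x =
      (∫⁻ u, excite γ (i + d + 1) (-u) * rhoUp g₀ γ i d (x - u)) +
      if d = 0 then excite γ (i + 1) (-x) * (g₀ * m γ i) else 0 := by
  simpa using rhoUp_succ_sub (g₀ := g₀) (γ := γ) i d x 0

theorem measurable_rhoUp (hγ : ∀ n, 1 ≤ n → Measurable (γ n)) (i d : ℕ) :
    Measurable (rhoUp g₀ γ i d) := by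
  induction d with
  | zero => exact measurable_rhoDiag hγ i
  | succ d ih =>
    have hk := measurable_excite hγ (i + d)
    have hk' := measurable_excite hγ i
    simp_rw [funext (rhoUp_succ (g₀ := g₀) (γ := γ) i d)]
    refine Measurable.add ?_ ?_
    · exact Measurable.lintegral_prod_right' (f := fun p : ℝ × ℝ =>
        excite γ (i + d + 1) (-p.2) * rhoUp g₀ γ i d (p.1 - p.2)) (by fun_prop)
    · split_ifs <;> fun_prop

theorem measurable_rho (hγ : ∀ n, 1 ≤ n → Measurable (γ n)) (i j : ℕ) :
    Measurable (rho g₀ γ i j) := by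
  unfold rho
  split_ifs
  · exact measurable_rhoUp hγ _ _
  · exact (measurable_rhoUp hγ _ _).comp measurable_neg

theorem rho_swap (i j : ℕ) (x : ℝ) : rho g₀ γ j i x = rho g₀ γ i j (-x) := by
  rcases lt_trichotomy i j with h | rfl | h
  · simp [rho, h.le, h.not_ge]
  · simp [rho, rhoUp, rhoDiag_neg]
  · simp [rho, h.le, h.not_ge]

theorem rho_add (i d : ℕ) : rho g₀ γ i (i + d) = rhoUp g₀ γ i d := by
  funext x
  simp [rho]

theorem rho_self (i : ℕ) : rho g₀ γ i i = rhoDiag g₀ γ i := by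
  funext x
  simp [rho, rhoUp]

/-! ### Window bounds, finiteness and summability. -/

section Bounds

/-- The integrals of `f` over all intervals of length `τ` are at most `K`. -/
def WindowBound (τ : ℝ) (f : ℝ → ℝ≥0∞) (K : ℝ≥0∞) : Prop :=
  ∀ a, ∫⁻ x in Ioc a (a + τ), f x ≤ K

variable {τ : ℝ} {f w : ℝ → ℝ≥0∞} {K : ℝ≥0∞}

theorem setLIntegral_Ioc_sub (f : ℝ → ℝ≥0∞) (a b u : ℝ) :
    ∫⁻ x in Ioc a b, f (x - u) = ∫⁻ x in Ioc (a - u) (b - u), f x := by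
  rw [← lintegral_indicator measurableSet_Ioc, ← lintegral_indicator measurableSet_Ioc,
    ← lintegral_sub_right_eq_self ((Ioc (a - u) (b - u)).indicator f) u]
  refine lintegral_congr fun x => ?_
  simp [indicator]

/-- A translate of `f` satisfies the same bound, because windows may start anywhere; averaging
translates with weight `w` costs only the mass of `w`. -/
theorem WindowBound.conv (h : WindowBound τ f K) (hf : Measurable f) (hw : Measurable w) :
    WindowBound τ (fun x => ∫⁻ u, w u * f (x - u)) ((∫⁻ u, w u) * K) := by
  intro a
  rw [lintegral_lintegral_swap (by fun_prop), ← lintegral_mul_const _ hw]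
  refine lintegral_mono fun u => ?_
  rw [lintegral_const_mul _ (by fun_prop)]
  gcongr
  rw [setLIntegral_Ioc_sub, add_sub_right_comm]
  exact h _

theorem WindowBound.add {g : ℝ → ℝ≥0∞} {L : ℝ≥0∞} (h : WindowBound τ f K) (hf : Measurable f)
    (h' : WindowBound τ g L) : WindowBound τ (fun x => f x + g x) (K + L) := fun a => by
  rw [lintegral_add_left hf]
  exact add_le_add (h a) (h' a)

theorem WindowBound.of_lintegral_le (h : ∫⁻ x, f x ≤ K) : WindowBound τ f K := fun _ =>
  (setLIntegral_le_lintegral _ _).trans h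

theorem WindowBound.ae_lt_top (hτ : 0 < τ) (h : WindowBound τ f K) (hf : Measurable f)
    (hK : K ≠ ∞) : ∀ᵐ x, f x < ∞ := by
  have hU : (⋃ n : ℤ, Ioc (n • τ) ((n + 1) • τ)) = univ := iUnion_Ioc_zsmul hτ
  rw [← Measure.restrict_univ (μ := (volume : Measure ℝ)), ← hU, ae_restrict_iUnion_iff]
  intro n
  refine MeasureTheory.ae_lt_top hf (ne_top_of_le_ne_top hK ?_)
  have := h (n • τ)
  rwa [add_smul, one_smul]

variable {q : ℝ≥0∞}

theorem m_le_pow (hq : ∀ n, ∫⁻ x, excite γ (n + 1) x ≤ q) (i : ℕ) : m γ i ≤ q ^ i := by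
  induction i with
  | zero => simp [m]
  | succ i ih => rw [m_succ, pow_succ]; gcongr; exact hq i

theorem one_add_mul_inv_one_sub (hq1 : q < 1) : 1 + q * (1 - q)⁻¹ = (1 - q)⁻¹ := by
  have h0 : (1 - q) ≠ 0 := (tsub_pos_of_lt hq1).ne'
  have ht : (1 - q) ≠ ∞ := ne_top_of_le_ne_top ENNReal.one_ne_top tsub_le_self
  calc 1 + q * (1 - q)⁻¹ = (1 - q) * (1 - q)⁻¹ + q * (1 - q)⁻¹ := by
        rw [ENNReal.mul_inv_cancel h0 ht]
    _ = (1 - q)⁻¹ := by rw [← add_mul, tsub_add_cancel_of_le hq1.le, one_mul]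

/-- The constant in the bounds on the second-order densities. -/
noncomputable def diagConst (g₀ : ℝ≥0) (q : ℝ≥0∞) (τ : ℝ) : ℝ≥0∞ :=
  (g₀ : ℝ≥0∞) ^ 2 * ENNReal.ofReal τ + g₀ * (1 - q)⁻¹

theorem diagConst_ne_top (hq1 : q < 1) : diagConst g₀ q τ ≠ ∞ := by
  have h0 : (1 - q) ≠ 0 := (tsub_pos_of_lt hq1).ne'
  unfold diagConst
  finiteness

/-- One generation convolves with the kernel and with its reflection, which gives a factor `q ^ 2`,
and adds an integrable term of mass at most `g₀ * q ^ (i + 2)`. -/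
theorem windowBound_rhoDiag (hγ : ∀ n, 1 ≤ n → Measurable (γ n))
    (hq : ∀ n, ∫⁻ x, excite γ (n + 1) x ≤ q) (hq1 : q < 1) (i : ℕ) :
    WindowBound τ (rhoDiag g₀ γ i) (diagConst g₀ q τ * q ^ i) := by
  induction i with
  | zero =>
    intro a
    simp [rhoDiag, diagConst]
  | succ i ih =>
    have hk := measurable_excite hγ i
    have hr := measurable_rhoDiag (g₀ := g₀) hγ i
    have hc : Measurable fun x => ∫⁻ u, excite γ (i + 1) u * rhoDiag g₀ γ i (x - u) :=
      Measurable.lintegral_prod_right' (f := fun p : ℝ × ℝ =>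
        excite γ (i + 1) p.2 * rhoDiag g₀ γ i (p.1 - p.2)) (by fun_prop)
    have hcc : Measurable fun x => ∫⁻ v, excite γ (i + 1) (-v) *
        ∫⁻ u, excite γ (i + 1) u * rhoDiag g₀ γ i (x - v - u) :=
      Measurable.lintegral_prod_right' (f := fun p : ℝ × ℝ => excite γ (i + 1) (-p.2) *
        ∫⁻ u, excite γ (i + 1) u * rhoDiag g₀ γ i (p.1 - p.2 - u))
        (by exact (by fun_prop : Measurable fun p : ℝ × ℝ => excite γ (i + 1) (-p.2)).mul
              (hc.comp (by fun_prop : Measurable fun p : ℝ × ℝ => p.1 - p.2)))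
    have e : rhoDiag g₀ γ (i + 1) = fun x =>
        (∫⁻ v, excite γ (i + 1) (-v) *
          ∫⁻ u, excite γ (i + 1) u * rhoDiag g₀ γ i (x - v - u)) +
        ∫⁻ u, excite γ (i + 1) (x - u) * excite γ (i + 1) (-u) * (g₀ * m γ i) := by
      funext x
      have := rhoDiag_succ_sub (g₀ := g₀) hγ i x 0
      rw [sub_zero] at this
      rw [this]
      simp only [zero_sub]
      congr 1
      refine lintegral_congr fun v => ?_
      rw [← lintegral_const_mul _ (by fun_prop), ← lintegral_sub_left_eq_self _ x]
      refine lintegral_congr fun u => ?_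
      rw [sub_sub_cancel, sub_right_comm]
      ring
    have h1 := (ih.conv hr hk).conv hc (hk.comp measurable_neg)
    have h2 : ∫⁻ x, ∫⁻ u, excite γ (i + 1) (x - u) * excite γ (i + 1) (-u) * (g₀ * m γ i) ≤
        q * q * (g₀ * q ^ i) := by
      rw [lintegral_lintegral_swap (by fun_prop)]
      have : ∀ u, ∫⁻ x, excite γ (i + 1) (x - u) * excite γ (i + 1) (-u) * (g₀ * m γ i) =
          excite γ (i + 1) (-u) * ((∫⁻ x, excite γ (i + 1) x) * (g₀ * m γ i)) := by
        intro u
        simp_rw [mul_assoc]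
        rw [lintegral_mul_const _ (by fun_prop), lintegral_sub_right_eq_self (excite γ (i + 1)) u]
        ring
      simp_rw [this]
      rw [lintegral_mul_const _ (by fun_prop), lintegral_neg_eq_self (excite γ (i + 1)), ← mul_assoc]
      gcongr
      · exact hq i
      · exact hq i
      · exact m_le_pow hq i
    rw [e]
    intro a
    refine (h1.add hcc (WindowBound.of_lintegral_le h2) a).trans ?_
    simp only [Function.comp_apply]
    rw [lintegral_neg_eq_self (excite γ (i + 1))]
    have hqq := one_add_mul_inv_one_sub hq1
    -- This inequality closes the induction and explains the summand `g₀ * (1 - q)⁻¹`: it absorbs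
    -- the added term through `1 + q * (1 - q)⁻¹ = (1 - q)⁻¹`.
    have hle : q * diagConst g₀ q τ + q * g₀ ≤ diagConst g₀ q τ := by
      unfold diagConst
      calc _ = q * ((g₀ : ℝ≥0∞) ^ 2 * ENNReal.ofReal τ) +
            g₀ * (q * (1 + (1 - q)⁻¹)) := by ring
        _ ≤ 1 * ((g₀ : ℝ≥0∞) ^ 2 * ENNReal.ofReal τ) + g₀ * (1 + q * (1 - q)⁻¹) := by
          rw [mul_add, mul_one]
          gcongr
        _ = _ := by rw [hqq, one_mul]
    calc _ ≤ q * (q * (diagConst g₀ q τ * q ^ i)) + q * q * (g₀ * q ^ i) := by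
          gcongr <;> exact hq i
      _ = (q * diagConst g₀ q τ + q * g₀) * q ^ (i + 1) := by ring
      _ ≤ _ := by gcongr

theorem windowBound_rhoUp (hγ : ∀ n, 1 ≤ n → Measurable (γ n))
    (hq : ∀ n, ∫⁻ x, excite γ (n + 1) x ≤ q) (hq1 : q < 1) (i d : ℕ) :
    WindowBound τ (rhoUp g₀ γ i d) ((diagConst g₀ q τ + g₀) * q ^ (i + d)) := by
  have hdiag := windowBound_rhoDiag (g₀ := g₀) (τ := τ) hγ hq hq1 i
  -- The parent-child term enters only in the step from `d = 0` to `d = 1`, so `g₀` is added to the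
  -- constant exactly once.
  have key : ∀ d, WindowBound τ (rhoUp g₀ γ i d)
      ((diagConst g₀ q τ + if d = 0 then 0 else (g₀ : ℝ≥0∞)) * q ^ (i + d)) := by
    intro d
    induction d with
    | zero => simpa [rhoUp] using hdiag
    | succ d ih =>
      have hk := measurable_excite hγ (i + d)
      have hk' := measurable_excite hγ i
      have hr := measurable_rhoUp (g₀ := g₀) hγ i d
      have h1 := ih.conv hr (hk.comp measurable_neg)
      have hc : Measurable fun x => ∫⁻ u, excite γ (i + d + 1) (-u) * rhoUp g₀ γ i d (x - u) :=
        Measurable.lintegral_prod_right' (f := fun p : ℝ × ℝ =>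
          excite γ (i + d + 1) (-p.2) * rhoUp g₀ γ i d (p.1 - p.2)) (by fun_prop)
      have h2 : ∫⁻ x, (if d = 0 then excite γ (i + 1) (-x) * (g₀ * m γ i) else 0) ≤
          if d = 0 then q * (g₀ * q ^ i) else 0 := by
        split_ifs
        · rw [lintegral_mul_const _ (by fun_prop), lintegral_neg_eq_self (excite γ (i + 1))]
          gcongr
          · exact hq i
          · exact m_le_pow hq i
        · simp
      rw [funext (rhoUp_succ (g₀ := g₀) (γ := γ) i d)]
      intro a
      refine (h1.add hc (WindowBound.of_lintegral_le h2) a).trans ?_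
      simp only [Function.comp_apply]
      rw [lintegral_neg_eq_self (excite γ (i + d + 1))]
      refine (add_le_add (mul_le_mul' (hq (i + d)) le_rfl) le_rfl).trans (le_of_eq ?_)
      by_cases hd : d = 0
      · subst hd
        simp only [if_true, Nat.add_eq_zero_iff, one_ne_zero, and_false, if_false]
        ring
      · simp only [hd, if_false, Nat.add_eq_zero_iff, one_ne_zero, and_false]
        ring
  intro a
  refine (key d a).trans ?_
  gcongr
  split_ifs <;> simp

theorem ae_rho_lt_top (hγ : ∀ n, 1 ≤ n → Measurable (γ n))
    (hq : ∀ n, ∫⁻ x, excite γ (n + 1) x ≤ q) (hq1 : q < 1) (i j : ℕ) :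
    ∀ᵐ x : ℝ, rho g₀ γ i j x < ∞ := by
  have up : ∀ i d, ∀ᵐ x : ℝ, rhoUp g₀ γ i d x < ∞ := by
    intro i d
    refine (windowBound_rhoUp (τ := 1) hγ hq hq1 i d).ae_lt_top one_pos (measurable_rhoUp hγ i d) ?_
    have := diagConst_ne_top (g₀ := g₀) (τ := 1) hq1
    have := hq1.ne_top
    finiteness
  unfold rho
  split_ifs
  · exact up _ _
  · exact (Measure.measurePreserving_neg (volume : Measure ℝ)).quasiMeasurePreserving.ae (up _ _)

/-- For fixed `u`, the difference `s - u` runs through a window of length `τ`, so the window bound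
applies uniformly in `u`. -/
theorem setLIntegral_rho_le (hγ : ∀ n, 1 ≤ n → Measurable (γ n))
    (hq : ∀ n, ∫⁻ x, excite γ (n + 1) x ≤ q) (hq1 : q < 1) (i j : ℕ) :
    ∫⁻ u in Ioc 0 τ, ∫⁻ s in Ioc 0 τ, rho g₀ γ i j (s - u) ≤
      ENNReal.ofReal τ * ((diagConst g₀ q τ + g₀) * q ^ max i j) := by
  wlog hij : i ≤ j generalizing i j
  · have hr := measurable_rho (g₀ := g₀) hγ i j
    rw [lintegral_lintegral_swap (by fun_prop), max_comm]
    refine le_trans (le_of_eq ?_) (this j i (le_of_not_ge hij))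
    refine lintegral_congr fun u => lintegral_congr fun s => ?_
    rw [rho_swap j i, neg_sub]
  obtain ⟨d, rfl⟩ := Nat.exists_eq_add_of_le hij
  have hr := measurable_rho (g₀ := g₀) hγ i (i + d)
  simp_rw [setLIntegral_Ioc_sub (rho g₀ γ i (i + d))]
  refine (lintegral_mono fun u => ?_).trans (b :=
    ∫⁻ u in Ioc 0 τ, (diagConst g₀ q τ + g₀) * q ^ max i (i + d)) ?_
  · rw [rho_add, max_eq_right hij]
    rw [zero_sub, sub_eq_neg_add]
    exact windowBound_rhoUp hγ hq hq1 i d _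
  · simp [mul_comm]

theorem tsum_tsum_pow_max_lt_top (hq1 : q < 1) : ∑' i : ℕ, ∑' j : ℕ, q ^ max i j < ∞ := by
  -- Since `2 * max i j ≥ i + j`, the square root of `q` separates the double series into a product
  -- of two geometric ones.
  set r := q ^ (1 / 2 : ℝ) with hr
  have hrr : r ^ 2 = q := by
    rw [hr, ← ENNReal.rpow_natCast, ← ENNReal.rpow_mul]
    norm_num
  have hr1 : r < 1 := ENNReal.rpow_lt_one hq1 (by norm_num)
  have hle : ∀ i j : ℕ, q ^ max i j ≤ r ^ i * r ^ j := by
    intro i j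
    rw [← hrr, ← pow_mul, ← pow_add]
    exact pow_le_pow_right_of_le_one' hr1.le (by omega)
  refine (ENNReal.tsum_le_tsum fun i => ENNReal.tsum_le_tsum fun j => hle i j).trans_lt ?_
  simp_rw [ENNReal.tsum_mul_left, ENNReal.tsum_mul_right, ENNReal.tsum_geometric]
  have h0 : (1 - r) ≠ 0 := (tsub_pos_of_lt hr1).ne'
  finiteness

theorem secondOrderSum_univ_lt_top (hγ : ∀ n, 1 ≤ n → Measurable (γ n))
    (hq : ∀ n, ∫⁻ x, excite γ (n + 1) x ≤ q) (hq1 : q < 1) :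
    secondOrderSum g₀ γ univ univ τ < ∞ := by
  unfold secondOrderSum
  rw [tsum_univ fun i : ℕ => ∑' j : (univ : Set ℕ),
    ∫⁻ u in Ioc 0 τ, ∫⁻ s in Ioc 0 τ, rho g₀ γ i j (s - u)]
  simp_rw [fun i : ℕ => tsum_univ fun j : ℕ =>
    ∫⁻ u in Ioc 0 τ, ∫⁻ s in Ioc 0 τ, rho g₀ γ i j (s - u)]
  refine (ENNReal.tsum_le_tsum fun i => ENNReal.tsum_le_tsum fun j =>
    setLIntegral_rho_le hγ hq hq1 i j).trans_lt ?_
  simp_rw [ENNReal.tsum_mul_left]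
  have := diagConst_ne_top (g₀ := g₀) (τ := τ) hq1
  have := (tsum_tsum_pow_max_lt_top hq1).ne
  finiteness

theorem firstOrderSum_univ_lt_top (hq : ∀ n, ∫⁻ x, excite γ (n + 1) x ≤ q) (hq1 : q < 1) :
    firstOrderSum g₀ γ univ τ < ∞ := by
  unfold firstOrderSum
  rw [tsum_univ fun i : ℕ => g₀ * m γ i * ENNReal.ofReal τ]
  have hle : ∑' i, m γ i ≤ (1 - q)⁻¹ :=
    (ENNReal.tsum_le_tsum (m_le_pow hq)).trans (ENNReal.tsum_geometric q).le
  rw [ENNReal.tsum_mul_right, ENNReal.tsum_mul_left]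
  have h0 : (1 - q) ≠ 0 := (tsub_pos_of_lt hq1).ne'
  have : ∑' i, m γ i ≠ ∞ := ne_top_of_le_ne_top (by finiteness) hle
  finiteness

end Bounds

end HawkesGen

/-! ### Joint measurability of intensities, and the second-order densities of the generations. -/

namespace HawkesGen

theorem measurable_lintegral_history {Ω : Type*} {N : ℕ → Ω → Measure ℝ} {k n : ℕ} (hkn : k ≤ n) {f : ℝ → ℝ≥0∞}
    (hf : Measurable f) : Measurable[history N n] fun ω => ∫⁻ t, f t ∂(N k ω) := by
  refine (Measure.measurable_lintegral hf).comp (?_ : Measurable[history N n] (N k))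
  exact (comap_measurable (N k)).mono
    (le_iSup₂ (f := fun k (_ : k ≤ n) => MeasurableSpace.comap (N k) inferInstance) k hkn) le_rfl

variable {Ω : Type*} [mΩ : MeasurableSpace Ω]

/-- The kernel of a point process. -/
def IsSimplePointProcess.kernel {M : Ω → Measure ℝ} (hM : IsSimplePointProcess M) : Kernel Ω ℝ :=
  ⟨M, hM.measurable⟩

/-- Local finiteness gives no bound uniform in `ω`. Cutting the line into unit intervals, and `Ω`
according to the count in each, gives countably many finite kernels. This yields the joint
measurability of intensities that Tonelli needs. -/
theorem IsSimplePointProcess.isSFiniteKernel {M : Ω → Measure ℝ} (hM : IsSimplePointProcess M) :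
    IsSFiniteKernel hM.kernel := by
  classical
  have hI : ∀ n : ℤ, MeasurableSet (Ioc (n : ℝ) (n + 1)) := fun _ => measurableSet_Ioc
  have hms : ∀ p : ℤ × ℕ, MeasurableSet {ω | M ω (Ioc (p.1 : ℝ) (p.1 + 1)) = p.2} := fun p =>
    measurable_measure_apply hM.measurable (hI p.1) (measurableSet_singleton _)
  let κ : ℤ × ℕ → Kernel Ω ℝ := fun p => Kernel.piecewise (hms p) (hM.kernel.restrict (hI p.1)) 0
  have hκ : ∀ p, IsFiniteKernel (κ p) := fun p => by
    refine ⟨p.2, by finiteness, fun ω => ?_⟩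
    rw [Kernel.piecewise_apply]
    split_ifs with h
    · rw [Kernel.restrict_apply, Measure.restrict_apply_univ]
      exact le_of_eq h
    · simp
  have hsum : hM.kernel = Kernel.sum κ := by
    ext ω s hs
    have hsplit : M ω = Measure.sum fun n : ℤ => (M ω).restrict (Ioc (n : ℝ) (n + 1)) := by
      rw [← Measure.restrict_iUnion _ hI, iUnion_Ioc_intCast, Measure.restrict_univ]
      have := pairwise_disjoint_Ioc_intCast ℝ
      exact this
    rw [Kernel.sum_apply' _ _ hs, ENNReal.tsum_prod']
    change M ω s = _
    conv_lhs => rw [hsplit]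
    rw [Measure.sum_apply _ hs]
    refine tsum_congr fun n => ?_
    obtain ⟨c, hc⟩ := hM.exists_nat ω (hI n) (Metric.isBounded_Ioc _ _)
    rw [tsum_eq_single c]
    · have hω : ω ∈ {ω | M ω (Ioc ((n, c).1 : ℝ) ((n, c).1 + 1)) = (n, c).2} := hc
      rw [Kernel.piecewise_apply, if_pos hω, Kernel.restrict_apply]
      rfl
    · intro d hd
      rw [Kernel.piecewise_apply, if_neg]
      · simp
      · intro h
        exact hd (Nat.cast_injective (h.symm.trans hc))
  rw [hsum]
  infer_instance

theorem IsSimplePointProcess.measurable_lintegral {M : Ω → Measure ℝ}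
    (hM : IsSimplePointProcess M) {f : ℝ → ℝ → ℝ≥0∞} (hf : Measurable (Function.uncurry f)) :
    Measurable (Function.uncurry fun ω t => ∫⁻ s, f t s ∂(M ω)) := by
  have := hM.isSFiniteKernel
  exact Measurable.lintegral_kernel_prod_right' (κ := Kernel.prodMkRight ℝ hM.kernel)
    (f := fun p : (Ω × ℝ) × ℝ => f p.1.2 p.2)
    (hf.comp (measurable_fst.snd.prodMk measurable_snd))

variable {P : Measure Ω} {g₀ : ℝ≥0} {γ : ℕ → ℝ → ℝ≥0} {N : ℕ → Ω → Measure ℝ}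

namespace IsStationaryHawkes

theorem history_le (hN : IsStationaryHawkes P g₀ γ N) (n : ℕ) : history N n ≤ mΩ :=
  iSup₂_le fun k _ => (hN.pointProcess k).measurable.comap_le

theorem measurable_count (hN : IsStationaryHawkes P g₀ γ N) (n : ℕ) {B : Set ℝ}
    (hB : MeasurableSet B) : Measurable fun ω => N n ω B :=
  measurable_measure_apply (hN.pointProcess n).measurable hB

theorem measurable_lintegral (hN : IsStationaryHawkes P g₀ γ N) (n : ℕ) {f : ℝ → ℝ≥0∞}
    (hf : Measurable f) : Measurable fun ω => ∫⁻ t, f t ∂(N n ω) :=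
  measurable_lintegral_measure (hN.pointProcess n).measurable hf

theorem measurable_excited (hN : IsStationaryHawkes P g₀ γ N)
    (hγ : ∀ n, 1 ≤ n → Measurable (γ n)) (n : ℕ) :
    Measurable (Function.uncurry fun ω t => ∫⁻ s, excite γ (n + 1) (t - s) ∂(N n ω)) := by
  have hk := measurable_excite hγ n
  exact (hN.pointProcess n).measurable_lintegral (f := fun t s => excite γ (n + 1) (t - s))
    (by fun_prop)

theorem measurable_intensity (hN : IsStationaryHawkes P g₀ γ N)
    (hγ : ∀ n, 1 ≤ n → Measurable (γ n)) (n : ℕ) :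
    Measurable (Function.uncurry (intensity γ N n)) := by
  rw [show intensity γ N n = fun ω t => ∫⁻ s, excite γ (n + 1) (t - s) ∂(N n ω) from
    funext₂ (intensity_eq N n)]
  exact hN.measurable_excited hγ n

/-- The step down one generation: after Tonelli, the inner expectation involves only `Z` and
generation `n`, tested against the shifted kernel. -/
theorem lintegral_mul_compensator [SFinite P] (hN : IsStationaryHawkes P g₀ γ N)
    (hγ : ∀ n, 1 ≤ n → Measurable (γ n)) (n : ℕ) {Z : Ω → ℝ≥0∞} (hZ : Measurable Z)
    {g : ℝ → ℝ≥0∞} (hg : Measurable g) :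
    ∫⁻ ω, Z ω * ∫⁻ t, g t ∂(compensator (intensity γ N n) ω) ∂P =
      ∫⁻ t, g t * ∫⁻ ω, Z ω * ∫⁻ s, excite γ (n + 1) (t - s) ∂(N n ω) ∂P := by
  have hJ := hN.measurable_excited hγ n
  have hJω : ∀ ω, Measurable fun t => ∫⁻ s, excite γ (n + 1) (t - s) ∂(N n ω) :=
    fun ω => hJ.comp measurable_prodMk_left
  have hJt : ∀ t, Measurable fun ω => ∫⁻ s, excite γ (n + 1) (t - s) ∂(N n ω) :=
    fun t => hJ.comp measurable_prodMk_right
  simp_rw [lintegral_compensator (hN.measurable_intensity hγ n) _ hg, intensity_eq]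
  have e : ∀ ω, Z ω * ∫⁻ t, g t * ∫⁻ s, excite γ (n + 1) (t - s) ∂(N n ω) =
      ∫⁻ t, g t * (Z ω * ∫⁻ s, excite γ (n + 1) (t - s) ∂(N n ω)) := by
    intro ω
    rw [← lintegral_const_mul _ (hg.fun_mul (hJω ω))]
    exact lintegral_congr fun t => by ring
  simp_rw [e]
  rw [lintegral_lintegral_swap]
  · exact lintegral_congr fun t => lintegral_const_mul _ (hZ.fun_mul (hJt t))
  · exact ((hg.comp measurable_snd).mul ((hZ.comp measurable_fst).mul hJ)).aemeasurable

variable [IsProbabilityMeasure P]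

/-- The mean measure of generation `n` has the constant density `g₀ * m γ n`. -/
theorem lintegral_lintegral (hN : IsStationaryHawkes P g₀ γ N)
    (hγ : ∀ n, 1 ≤ n → Measurable (γ n)) (n : ℕ) {g : ℝ → ℝ≥0∞} (hg : Measurable g) :
    ∫⁻ ω, ∫⁻ t, g t ∂(N n ω) ∂P = g₀ * m γ n * ∫⁻ t, g t := by
  induction n generalizing g with
  | zero =>
    have hc : Measurable (Function.uncurry fun (_ : Ω) (_ : ℝ) => (g₀ : ℝ≥0∞)) := measurable_const
    have := hN.immigrants.lintegral_mul_lintegral bot_le (hN.pointProcess 0) hc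
      (Z := fun _ => 1) measurable_const hg
    simp only [one_mul, lintegral_compensator hc _ hg] at this
    rw [this, lintegral_mul_const _ hg]
    simp [m, mul_comm]
  | succ n ih =>
    have hk := measurable_excite hγ n
    have := (hN.offspring n).lintegral_mul_lintegral (hN.history_le n) (hN.pointProcess (n + 1))
      (hN.measurable_intensity hγ n) (Z := fun _ => 1) measurable_const hg
    rw [hN.lintegral_mul_compensator hγ n measurable_const hg] at this
    simp only [one_mul] at this
    rw [this]
    have e : ∀ t, ∫⁻ ω, ∫⁻ s, excite γ (n + 1) (t - s) ∂(N n ω) ∂P = g₀ * m γ (n + 1) := by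
      intro t
      rw [ih (by fun_prop), lintegral_excite_sub_left, m_succ, lintegral_excite, mul_assoc]
    simp_rw [e]
    rw [lintegral_mul_const _ hg, mul_comm]

/-- The product of compensator integrals becomes a moment of generation `i` tested against two
shifted kernels. The two terms of the induction hypothesis there are the two terms of the recursion:
distinct parents and a common parent. -/
theorem lintegral_mul_rhoDiag (hN : IsStationaryHawkes P g₀ γ N)
    (hγ : ∀ n, 1 ≤ n → Measurable (γ n)) (i : ℕ) {f g : ℝ → ℝ≥0∞} (hf : Measurable f)
    (hg : Measurable g) :
    ∫⁻ ω, (∫⁻ t, f t ∂(N i ω)) * ∫⁻ s, g s ∂(N i ω) ∂P =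
      (∫⁻ t, ∫⁻ s, f t * g s * rhoDiag g₀ γ i (t - s)) +
        g₀ * m γ i * ∫⁻ t, f t * g t := by
  induction i generalizing f g with
  | zero =>
    have hc : Measurable (Function.uncurry fun (_ : Ω) (_ : ℝ) => (g₀ : ℝ≥0∞)) := measurable_const
    rw [hN.immigrants.lintegral_lintegral_mul_lintegral (hN.pointProcess 0) hc hf hg]
    simp only [lintegral_compensator hc _ hf, lintegral_compensator hc _ hg,
      lintegral_compensator hc _ (hf.fun_mul hg), lintegral_const, measure_univ, mul_one, rhoDiag]
    congr 1
    · rw [lintegral_mul_const _ hf, lintegral_mul_const _ hg]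
      simp_rw [lintegral_mul_const _ (hg.const_mul _), lintegral_const_mul _ hg]
      rw [lintegral_mul_const _ (hf.mul_const _), lintegral_mul_const _ hf]
      ring
    · rw [lintegral_mul_const _ (hf.fun_mul hg)]
      simp [m, mul_comm]
  | succ i ih =>
    have hk := measurable_excite hγ i
    have hr := measurable_rhoDiag (g₀ := g₀) hγ i
    have hI := hN.measurable_intensity hγ i
    have hL := measurable_compensator hI
    rw [(hN.offspring i).lintegral_lintegral_mul_lintegral (hN.pointProcess (i + 1)) hI hf hg,
      lintegral_add_left ((measurable_lintegral_measure hL hf).fun_mul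
        (measurable_lintegral_measure hL hg))]
    congr 1
    · simp_rw [mul_comm (∫⁻ t, f t ∂_)]
      -- The reduction is used twice: for `f`, with the compensator integral of `g` as weight, and
      -- then for `g`, with the kernel shifted to `t` as weight.
      rw [hN.lintegral_mul_compensator hγ i (measurable_lintegral_measure hL hg) hf]
      refine lintegral_congr fun t => ?_
      simp_rw [mul_comm (∫⁻ t, g t ∂_), mul_assoc]
      have hr' := measurable_rhoDiag (g₀ := g₀) hγ (i + 1)
      rw [hN.lintegral_mul_compensator hγ i (hN.measurable_lintegral i (by fun_prop)) hg,
        lintegral_const_mul _ (by fun_prop)]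
      congr 1
      refine lintegral_congr fun s => ?_
      rw [ih (by fun_prop) (by fun_prop), rhoDiag_succ_sub hγ]
      congr 2
      · rw [lintegral_lintegral_swap (by fun_prop)]
      · rw [lintegral_mul_const _ (by fun_prop), mul_comm]
    · have := (hN.offspring i).lintegral_mul_lintegral (hN.history_le i) (hN.pointProcess (i + 1))
        hI (Z := fun _ => 1) measurable_const (hf.fun_mul hg)
      simp only [one_mul] at this
      rw [← this, hN.lintegral_lintegral hγ (i + 1) (hf.fun_mul hg)]

/-- Generation `i` belongs to the history on which the later generation is conditioned, so the
first-moment formula suffices. The diagonal mass present at `d = 0` turns into the parent-child term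
at `d = 1`. -/
theorem lintegral_mul_rhoUp (hN : IsStationaryHawkes P g₀ γ N)
    (hγ : ∀ n, 1 ≤ n → Measurable (γ n)) (i d : ℕ) {f g : ℝ → ℝ≥0∞} (hf : Measurable f)
    (hg : Measurable g) :
    ∫⁻ ω, (∫⁻ t, f t ∂(N i ω)) * ∫⁻ s, g s ∂(N (i + d) ω) ∂P =
      (∫⁻ t, ∫⁻ s, f t * g s * rhoUp g₀ γ i d (t - s)) +
        if d = 0 then g₀ * m γ i * ∫⁻ t, f t * g t else 0 := by
  induction d generalizing f g with
  | zero => simpa [rhoUp] using hN.lintegral_mul_rhoDiag hγ i hf hg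
  | succ d ih =>
    have hk := measurable_excite hγ (i + d)
    have hk' := measurable_excite hγ i
    have hr := measurable_rhoUp (g₀ := g₀) hγ i d
    have hr' := measurable_rhoUp (g₀ := g₀) hγ i (d + 1)
    have hconv : Measurable fun p : ℝ × ℝ =>
        ∫⁻ u, excite γ (i + d + 1) (p.2 - u) * rhoUp g₀ γ i d (p.1 - u) :=
      Measurable.lintegral_prod_right' (f := fun p : (ℝ × ℝ) × ℝ =>
        excite γ (i + d + 1) (p.1.2 - p.2) * rhoUp g₀ γ i d (p.1.1 - p.2)) (by fun_prop)
    rw [← add_assoc, (hN.offspring (i + d)).lintegral_mul_lintegral (hN.history_le (i + d))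
      (hN.pointProcess (i + d + 1)) (hN.measurable_intensity hγ (i + d))
      (measurable_lintegral_history (Nat.le_add_right i d) hf) hg,
      hN.lintegral_mul_compensator hγ (i + d) (hN.measurable_lintegral i hf) hg,
      if_neg (Nat.succ_ne_zero d), add_zero, lintegral_lintegral_swap (by fun_prop)]
    refine lintegral_congr fun s => ?_
    rw [ih hf (by fun_prop)]
    simp_rw [mul_comm (f _), mul_assoc]
    rw [lintegral_const_mul _ (by fun_prop)]
    congr 1
    simp_rw [rhoUp_succ_sub, mul_add]
    rw [lintegral_add_left (by fun_prop)]
    congr 1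
    · refine lintegral_congr fun t => ?_
      rw [← lintegral_const_mul _ (by fun_prop)]
      exact lintegral_congr fun u => by ring
    · split_ifs with hd
      · subst hd
        rw [← mul_assoc, ← lintegral_const_mul _ (by fun_prop)]
        refine lintegral_congr fun t => ?_
        rw [add_zero]
        ring
      · simp

/-- The functions `rho` are the second-order densities of the generations. -/
theorem lintegral_count_mul_count (hN : IsStationaryHawkes P g₀ γ N)
    (hγ : ∀ n, 1 ≤ n → Measurable (γ n)) (i j : ℕ) {B C : Set ℝ} (hB : MeasurableSet B)
    (hC : MeasurableSet C) :
    ∫⁻ ω, N i ω B * N j ω C ∂P =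
      (∫⁻ t in B, ∫⁻ s in C, rho g₀ γ i j (t - s)) +
        if i = j then g₀ * m γ i * volume (B ∩ C) else 0 := by
  wlog hij : i ≤ j generalizing i j B C
  · have hr := measurable_rho (g₀ := g₀) hγ j i
    simp_rw [mul_comm (N i _ B)]
    rw [this j i hC hB (le_of_not_ge hij), lintegral_lintegral_swap (by fun_prop),
      if_neg (by omega), if_neg (by omega)]
    congr 1
    refine lintegral_congr fun u => lintegral_congr fun s => ?_
    rw [rho_swap i j, neg_sub]
  obtain ⟨d, rfl⟩ := Nat.exists_eq_add_of_le hij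
  have h1 : Measurable (B.indicator (1 : ℝ → ℝ≥0∞)) := measurable_one.indicator hB
  have h2 : Measurable (C.indicator (1 : ℝ → ℝ≥0∞)) := measurable_one.indicator hC
  have := hN.lintegral_mul_rhoUp hγ i d h1 h2
  simp only [lintegral_indicator_one hB, lintegral_indicator_one hC] at this
  rw [this, rho_add]
  congr 1
  · rw [← lintegral_indicator hB]
    refine lintegral_congr fun t => ?_
    by_cases ht : t ∈ B
    · simp only [indicator_of_mem ht, Pi.one_apply, one_mul]
      rw [← lintegral_indicator hC]
      refine lintegral_congr fun s => ?_
      by_cases hs : s ∈ C <;> simp [hs]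
    · simp [ht]
  · have : ∀ t, B.indicator (1 : ℝ → ℝ≥0∞) t * C.indicator 1 t =
        (B ∩ C).indicator (1 : ℝ → ℝ≥0∞) t := fun t => by
      rw [inter_indicator_one]
      rfl
    simp_rw [this, lintegral_indicator_one (hB.inter hC)]
    simp

end IsStationaryHawkes

end HawkesGen

namespace HawkesGen

/-! ### The recursive formulas for `rho`. -/

section Recursion

variable {g₀ : ℝ≥0} {γ : ℕ → ℝ → ℝ≥0}

theorem rho_self_succ_sub (hγ : ∀ n, 1 ≤ n → Measurable (γ n)) (i : ℕ) {t s : ℝ} (hst : s < t) :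
    rho g₀ γ (i + 1) (i + 1) (t - s) =
      (∫⁻ v in Iio s, ∫⁻ u in Iio t, (γ (i + 1) (t - u) : ℝ≥0∞) * γ (i + 1) (s - v) *
        rho g₀ γ i i |u - v|) +
      ∫⁻ u in Iio s, (γ (i + 1) (t - u) : ℝ≥0∞) * γ (i + 1) (s - u) * (g₀ * m γ i) := by
  rw [rho_self, rho_self, rhoDiag_succ_sub hγ, setLIntegral_Iio_mul_mul _ hst.le,
    setLIntegral_Iio_Iio (i + 1) t s (fun u v => rhoDiag g₀ γ i |u - v|)]
  simp_rw [rhoDiag_abs]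

theorem rho_succ_sub (i : ℕ) (t s : ℝ) :
    rho g₀ γ i (i + 1) (t - s) =
      (∫⁻ u in Iio s, (γ (i + 1) (s - u) : ℝ≥0∞) * rho g₀ γ i i (t - u)) +
      excite γ (i + 1) (s - t) * (g₀ * m γ i) := by
  rw [rho_add, rhoUp_succ_sub, setLIntegral_Iio_mul, rho_self, if_pos rfl]
  rfl

theorem rho_sub_of_add_two_le {i j : ℕ} (hij : i + 2 ≤ j) (t s : ℝ) :
    rho g₀ γ i j (t - s) =
      ∫⁻ u in Iio s, (γ j (s - u) : ℝ≥0∞) * rho g₀ γ i (j - 1) (t - u) := by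
  obtain ⟨k, rfl⟩ := Nat.exists_eq_add_of_le hij
  rw [show i + 2 + k = i + (k + 1 + 1) by ring, show i + (k + 1 + 1) - 1 = i + (k + 1) by omega,
    rho_add, rho_add, rhoUp_succ_sub, setLIntegral_Iio_mul, if_neg (Nat.succ_ne_zero k), add_zero]
  rfl

end Recursion

/-! ### Moments of group counts and prices. -/

section Groups

theorem groupCount_mono {Ω : Type*} (N : ℕ → Ω → Measure ℝ) {A B : Set ℕ} (hAB : A ⊆ B) (τ : ℝ)
    (ω : Ω) : groupCount N A τ ω ≤ groupCount N B τ ω :=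
  ENNReal.tsum_mono_subtype (fun n => N n ω (Ioc 0 τ)) hAB

variable {Ω : Type*} [MeasurableSpace Ω] {P : Measure Ω} {g₀ : ℝ≥0} {γ : ℕ → ℝ → ℝ≥0}
  {N : ℕ → Ω → Measure ℝ}

namespace IsStationaryHawkes

theorem measurable_groupCount (hN : IsStationaryHawkes P g₀ γ N) (A : Set ℕ) (τ : ℝ) :
    Measurable (groupCount N A τ) :=
  Measurable.tsum fun n : A => hN.measurable_count n measurableSet_Ioc

theorem ae_groupCount_lt_top (hN : IsStationaryHawkes P g₀ γ N) {τ : ℝ} {A : Set ℕ}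
    (h : ∫⁻ ω, groupCount N A τ ω * groupCount N A τ ω ∂P ≠ ∞) :
    ∀ᵐ ω ∂P, groupCount N A τ ω < ∞ := by
  have hm := hN.measurable_groupCount A τ
  filter_upwards [ae_lt_top (hm.fun_mul hm) h] with ω hω
  by_contra hc
  simp [top_le_iff.1 (not_lt.1 hc)] at hω

theorem integrable_toReal_groupCount_mul (hN : IsStationaryHawkes P g₀ γ N) {τ : ℝ} {A B : Set ℕ}
    (h : ∫⁻ ω, groupCount N A τ ω * groupCount N B τ ω ∂P ≠ ∞) :
    Integrable (fun ω => (groupCount N A τ ω).toReal * (groupCount N B τ ω).toReal) P := by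
  have := integrable_toReal_of_lintegral_ne_top
    ((hN.measurable_groupCount A τ).fun_mul (hN.measurable_groupCount B τ)).aemeasurable h
  simpa only [ENNReal.toReal_mul] using this

theorem integral_toReal_groupCount_mul (hN : IsStationaryHawkes P g₀ γ N) {τ : ℝ} {A B : Set ℕ}
    (h : ∫⁻ ω, groupCount N A τ ω * groupCount N B τ ω ∂P ≠ ∞) :
    ∫ ω, (groupCount N A τ ω).toReal * (groupCount N B τ ω).toReal ∂P =
      (∫⁻ ω, groupCount N A τ ω * groupCount N B τ ω ∂P).toReal := by
  have hm := (hN.measurable_groupCount A τ).fun_mul (hN.measurable_groupCount B τ)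
  have := integral_toReal hm.aemeasurable (ae_lt_top hm h)
  simpa only [ENNReal.toReal_mul] using this

theorem memLp_price (hN : IsStationaryHawkes P g₀ γ N) {τ : ℝ}
    (h : ∀ A B, ∫⁻ ω, groupCount N A τ ω * groupCount N B τ ω ∂P ≠ ∞) (A B : Set ℕ) :
    MemLp (price N A B τ) 2 P := by
  have key : ∀ A, MemLp (fun ω => (groupCount N A τ ω).toReal) 2 P := fun A => by
    rw [memLp_two_iff_integrable_sq (hN.measurable_groupCount A τ).ennreal_toReal.aestronglyMeasurable]
    simpa only [sq] using hN.integrable_toReal_groupCount_mul (h A A)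
  exact (key A).sub (key B)

/-- Finiteness of all mixed moments makes the four products integrable, so the bilinear expansion
can be integrated term by term. -/
theorem integral_price_mul_price (hN : IsStationaryHawkes P g₀ γ N) {τ : ℝ}
    (h : ∀ A B, ∫⁻ ω, groupCount N A τ ω * groupCount N B τ ω ∂P ≠ ∞) (A B C D : Set ℕ) :
    ∫ ω, price N A B τ ω * price N C D τ ω ∂P =
      (∫⁻ ω, groupCount N A τ ω * groupCount N C τ ω ∂P).toReal +
      (∫⁻ ω, groupCount N B τ ω * groupCount N D τ ω ∂P).toReal -
      (∫⁻ ω, groupCount N B τ ω * groupCount N C τ ω ∂P).toReal -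
      (∫⁻ ω, groupCount N A τ ω * groupCount N D τ ω ∂P).toReal := by
  have hi := fun A B => hN.integrable_toReal_groupCount_mul (h A B)
  simp_rw [← hN.integral_toReal_groupCount_mul (h _ _)]
  rw [← integral_add' (hi A C) (hi B D), ← integral_sub' ((hi A C).add (hi B D)) (hi B C),
    ← integral_sub' (((hi A C).add (hi B D)).sub (hi B C)) (hi A D)]
  refine integral_congr_ae (.of_forall fun ω => ?_)
  simp only [price, Pi.add_apply, Pi.sub_apply]
  ring

variable [IsProbabilityMeasure P]

/-- Nonnegative series may be multiplied and integrated termwise. The diagonal masses are kept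
apart, since they vanish for disjoint groups and sum to `firstOrderSum` for equal ones. -/
theorem lintegral_groupCount_mul (hN : IsStationaryHawkes P g₀ γ N)
    (hγ : ∀ n, 1 ≤ n → Measurable (γ n)) (A B : Set ℕ) (τ : ℝ) :
    ∫⁻ ω, groupCount N A τ ω * groupCount N B τ ω ∂P =
      secondOrderSum g₀ γ A B τ +
        ∑' i : A, ∑' j : B,
          if (i : ℕ) = j then g₀ * m γ i * ENNReal.ofReal τ else 0 := by
  have hm : ∀ n, Measurable fun ω => N n ω (Ioc 0 τ) :=
    fun n => hN.measurable_count n measurableSet_Ioc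
  unfold groupCount secondOrderSum
  simp_rw [← ENNReal.tsum_mul_right, ← ENNReal.tsum_mul_left]
  rw [lintegral_tsum fun i : A => (Measurable.tsum fun j : B =>
      (hm i).fun_mul (hm j)).aemeasurable, ← ENNReal.tsum_add]
  refine tsum_congr fun i => ?_
  rw [lintegral_tsum fun j : B => ((hm i).fun_mul (hm j)).aemeasurable, ← ENNReal.tsum_add]
  refine tsum_congr fun j => ?_
  have hr := measurable_rho (g₀ := g₀) hγ i j
  rw [hN.lintegral_count_mul_count hγ i j measurableSet_Ioc measurableSet_Ioc, inter_self,
    Real.volume_Ioc, sub_zero, lintegral_lintegral_swap (by fun_prop)]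

theorem lintegral_groupCount_mul_of_disjoint (hN : IsStationaryHawkes P g₀ γ N)
    (hγ : ∀ n, 1 ≤ n → Measurable (γ n)) {A B : Set ℕ} (hAB : Disjoint A B) (τ : ℝ) :
    ∫⁻ ω, groupCount N A τ ω * groupCount N B τ ω ∂P = secondOrderSum g₀ γ A B τ := by
  rw [hN.lintegral_groupCount_mul hγ]
  have : ∀ (i : A) (j : B), (i : ℕ) ≠ j := fun i j => hAB.ne_of_mem i.2 j.2
  simp [this]

theorem lintegral_groupCount_mul_self (hN : IsStationaryHawkes P g₀ γ N)
    (hγ : ∀ n, 1 ≤ n → Measurable (γ n)) (A : Set ℕ) (τ : ℝ) :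
    ∫⁻ ω, groupCount N A τ ω * groupCount N A τ ω ∂P =
      firstOrderSum g₀ γ A τ + secondOrderSum g₀ γ A A τ := by
  rw [hN.lintegral_groupCount_mul hγ, add_comm]
  congr 1
  refine tsum_congr fun i => ?_
  rw [tsum_eq_single i fun j hj => if_neg fun h => hj (Subtype.ext h.symm), if_pos rfl]

/-- All second moments of the group counts are finite. -/
theorem lintegral_groupCount_mul_ne_top (hN : IsStationaryHawkes P g₀ γ N)
    (hγ : ∀ n, 1 ≤ n → Measurable (γ n)) {τ : ℝ}
    (h1 : firstOrderSum g₀ γ univ τ < ∞) (h2 : secondOrderSum g₀ γ univ univ τ < ∞) (A B : Set ℕ) :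
    ∫⁻ ω, groupCount N A τ ω * groupCount N B τ ω ∂P ≠ ∞ := by
  refine ne_top_of_le_ne_top (b := ∫⁻ ω, groupCount N univ τ ω * groupCount N univ τ ω ∂P) ?_
    (lintegral_mono fun ω => mul_le_mul' (groupCount_mono N (subset_univ A) τ ω)
      (groupCount_mono N (subset_univ B) τ ω))
  rw [hN.lintegral_groupCount_mul_self hγ]
  exact (ENNReal.add_lt_top.2 ⟨h1, h2⟩).ne

theorem integral_price_sq (hN : IsStationaryHawkes P g₀ γ N)
    (hγ : ∀ n, 1 ≤ n → Measurable (γ n)) {τ : ℝ}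
    (h1 : firstOrderSum g₀ γ univ τ < ∞) (h2 : secondOrderSum g₀ γ univ univ τ < ∞) {A B : Set ℕ}
    (hAB : Disjoint A B) :
    ∫ ω, (price N A B τ ω) ^ 2 ∂P =
      (firstOrderSum g₀ γ A τ).toReal + (secondOrderSum g₀ γ A A τ).toReal +
      (firstOrderSum g₀ γ B τ).toReal + (secondOrderSum g₀ γ B B τ).toReal -
      2 * (secondOrderSum g₀ γ A B τ).toReal := by
  have h := hN.lintegral_groupCount_mul_ne_top hγ h1 h2
  have hself : ∀ A, (∫⁻ ω, groupCount N A τ ω * groupCount N A τ ω ∂P).toReal =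
      (firstOrderSum g₀ γ A τ).toReal + (secondOrderSum g₀ γ A A τ).toReal := by
    intro A
    have hA := h A A
    rw [hN.lintegral_groupCount_mul_self hγ] at hA ⊢
    exact ENNReal.toReal_add (ENNReal.add_ne_top.1 hA).1 (ENNReal.add_ne_top.1 hA).2
  simp_rw [sq]
  rw [hN.integral_price_mul_price h, hself, hself]
  simp_rw [mul_comm (groupCount N B τ _) (groupCount N A τ _)]
  rw [hN.lintegral_groupCount_mul_of_disjoint hγ hAB]
  ring

end IsStationaryHawkes

end Groups

end HawkesGen

/-! ### Assembly. -/

theorem mainTheorem9 {Ω : Type*} [MeasurableSpace Ω] (P : Measure Ω) [IsProbabilityMeasure P]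
    (g₀ : ℝ≥0) (hg₀ : 0 < g₀)
    (γ : ℕ → ℝ → ℝ≥0) (hγ : ∀ n, 1 ≤ n → Measurable (γ n))
    (hsub : (⨆ n : ℕ, ∫⁻ t in Ioi (0 : ℝ), (γ (n + 1) t : ℝ≥0∞)) < (1 : ℝ≥0∞))
    (N : ℕ → Ω → Measure ℝ) (hN : HawkesGen.IsStationaryHawkes P g₀ γ N)
    (A : Fin 4 → Set ℕ) (hdisj : Pairwise (fun k l => Disjoint (A k) (A l)))
    (hcover : (⋃ k, A k) = Set.univ) :
    -- the recursive formulas for `ρ`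
    (∀ t s : ℝ, s < t → HawkesGen.rho g₀ γ 0 0 (t - s) = (g₀ : ℝ≥0∞) ^ 2) ∧
    (∀ (i : ℕ) (t s : ℝ), 1 ≤ i → s < t →
      HawkesGen.rho g₀ γ i i (t - s) =
        (∫⁻ v in Iio s, ∫⁻ u in Iio t, (γ i (t - u) : ℝ≥0∞) * γ i (s - v) *
          HawkesGen.rho g₀ γ (i - 1) (i - 1) |u - v|) +
        ∫⁻ u in Iio s, (γ i (t - u) : ℝ≥0∞) * γ i (s - u) * (g₀ * HawkesGen.m γ (i - 1))) ∧
    (∀ (i : ℕ) (x : ℝ), HawkesGen.rho g₀ γ i i (-x) = HawkesGen.rho g₀ γ i i x) ∧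
    (∀ (i j : ℕ) (x : ℝ), HawkesGen.rho g₀ γ j i x = HawkesGen.rho g₀ γ i j (-x)) ∧
    (∀ (i : ℕ) (t s : ℝ), s < t →
      HawkesGen.rho g₀ γ i (i + 1) (t - s) =
        ∫⁻ u in Iio s, (γ (i + 1) (s - u) : ℝ≥0∞) * HawkesGen.rho g₀ γ i i (t - u)) ∧
    (∀ (i : ℕ) (t s : ℝ), t < s →
      HawkesGen.rho g₀ γ i (i + 1) (t - s) =
        (∫⁻ u in Iio s, (γ (i + 1) (s - u) : ℝ≥0∞) * HawkesGen.rho g₀ γ i i (t - u)) +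
        (γ (i + 1) (s - t) : ℝ≥0∞) * (g₀ * HawkesGen.m γ i)) ∧
    (∀ (i j : ℕ) (t s : ℝ), i + 2 ≤ j →
      HawkesGen.rho g₀ γ i j (t - s) =
        ∫⁻ u in Iio s, (γ j (s - u) : ℝ≥0∞) * HawkesGen.rho g₀ γ i (j - 1) (t - u)) ∧
    -- `ρ` is almost everywhere finite, and is the second-order density of the generations
    (∀ i j : ℕ, ∀ᵐ x : ℝ, HawkesGen.rho g₀ γ i j x < ∞) ∧
    (∀ (i j : ℕ) (B C : Set ℝ), MeasurableSet B → MeasurableSet C →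
      ∫⁻ ω, N i ω B * N j ω C ∂P =
        (∫⁻ t in B, ∫⁻ s in C, HawkesGen.rho g₀ γ i j (t - s)) +
        if i = j then g₀ * HawkesGen.m γ i * volume (B ∩ C) else 0) ∧
    -- the second moments and the cross moment
    (∀ τ : ℝ, 0 < τ →
      (∀ᵐ ω ∂P, HawkesGen.groupCount N Set.univ τ ω < ∞) ∧
      MemLp (HawkesGen.price N (A 0) (A 1) τ) 2 P ∧
      MemLp (HawkesGen.price N (A 2) (A 3) τ) 2 P ∧
      HawkesGen.firstOrderSum g₀ γ Set.univ τ < ∞ ∧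
      HawkesGen.secondOrderSum g₀ γ Set.univ Set.univ τ < ∞ ∧
      ∫ ω, (HawkesGen.price N (A 0) (A 1) τ ω) ^ 2 ∂P =
        (HawkesGen.firstOrderSum g₀ γ (A 0) τ).toReal +
        (HawkesGen.secondOrderSum g₀ γ (A 0) (A 0) τ).toReal +
        (HawkesGen.firstOrderSum g₀ γ (A 1) τ).toReal +
        (HawkesGen.secondOrderSum g₀ γ (A 1) (A 1) τ).toReal -
        2 * (HawkesGen.secondOrderSum g₀ γ (A 0) (A 1) τ).toReal ∧
      ∫ ω, (HawkesGen.price N (A 2) (A 3) τ ω) ^ 2 ∂P =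
        (HawkesGen.firstOrderSum g₀ γ (A 2) τ).toReal +
        (HawkesGen.secondOrderSum g₀ γ (A 2) (A 2) τ).toReal +
        (HawkesGen.firstOrderSum g₀ γ (A 3) τ).toReal +
        (HawkesGen.secondOrderSum g₀ γ (A 3) (A 3) τ).toReal -
        2 * (HawkesGen.secondOrderSum g₀ γ (A 2) (A 3) τ).toReal ∧
      ∫ ω, HawkesGen.price N (A 0) (A 1) τ ω * HawkesGen.price N (A 2) (A 3) τ ω ∂P =
        (HawkesGen.secondOrderSum g₀ γ (A 0) (A 2) τ).toReal +
        (HawkesGen.secondOrderSum g₀ γ (A 1) (A 3) τ).toReal -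
        (HawkesGen.secondOrderSum g₀ γ (A 1) (A 2) τ).toReal -
        (HawkesGen.secondOrderSum g₀ γ (A 0) (A 3) τ).toReal) := by
  -- The supremum itself serves as the contraction constant `q`.
  have hq : ∀ n, ∫⁻ x, HawkesGen.excite γ (n + 1) x ≤
      ⨆ n : ℕ, ∫⁻ t in Ioi (0 : ℝ), (γ (n + 1) t : ℝ≥0∞) := fun n => by
    rw [HawkesGen.lintegral_excite]
    exact le_iSup (fun n => ∫⁻ t in Ioi (0 : ℝ), (γ (n + 1) t : ℝ≥0∞)) n
  refine ⟨fun t s _ => by rw [HawkesGen.rho_self, HawkesGen.rhoDiag], ?_,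
    fun i x => by rw [HawkesGen.rho_self, HawkesGen.rhoDiag_neg],
    fun i j x => HawkesGen.rho_swap i j x, fun i t s hst => ?_, fun i t s hst => ?_,
    fun i j t s hij => HawkesGen.rho_sub_of_add_two_le hij t s,
    HawkesGen.ae_rho_lt_top hγ hq hsub,
    fun i j B C hB hC => hN.lintegral_count_mul_count hγ i j hB hC, fun τ _ => ?_⟩
  · intro i t s hi hst
    obtain ⟨k, rfl⟩ := Nat.exists_eq_add_of_le' hi
    exact HawkesGen.rho_self_succ_sub hγ k hst
  · rw [HawkesGen.rho_succ_sub, HawkesGen.excite, if_neg (by linarith), zero_mul, add_zero]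
  · rw [HawkesGen.rho_succ_sub, HawkesGen.excite, if_pos (by linarith)]
  · have h1 := HawkesGen.firstOrderSum_univ_lt_top (g₀ := g₀) (τ := τ) hq hsub
    have h2 := HawkesGen.secondOrderSum_univ_lt_top (g₀ := g₀) (τ := τ) hγ hq hsub
    have h := hN.lintegral_groupCount_mul_ne_top hγ h1 h2
    have hd : ∀ k l : Fin 4, k ≠ l → Disjoint (A k) (A l) := fun k l hkl => hdisj hkl
    refine ⟨hN.ae_groupCount_lt_top (h univ univ), hN.memLp_price h _ _, hN.memLp_price h _ _,
      h1, h2, hN.integral_price_sq hγ h1 h2 (hd 0 1 (by decide)),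
      hN.integral_price_sq hγ h1 h2 (hd 2 3 (by decide)), ?_⟩
    rw [hN.integral_price_mul_price h,
      hN.lintegral_groupCount_mul_of_disjoint hγ (hd 0 2 (by decide)),
      hN.lintegral_groupCount_mul_of_disjoint hγ (hd 1 3 (by decide)),
      hN.lintegral_groupCount_mul_of_disjoint hγ (hd 1 2 (by decide)),
      hN.lintegral_groupCount_mul_of_disjoint hγ (hd 0 3 (by decide))]
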